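/- Let $\mathbb{D}$ be the open unit disc, let $m$ be the normalized Lebesgue measure on the unit circle $\partial\mathbb{D}$ (so $m(\partial\mathbb{D})=1$), and let $W:(0,1]\to(0,1]$ be a continuous non-decreasing function with $\lim_{t\to0+}W(t)=0$. Assume that $W$ is a good weight, i.e. there is $C>1$ such that $$\log\frac{1}{W(t/2)}\le C\log\frac1{W(t)}\qquad\text{for all sufficiently small } t>0,$$ and that $W$ is Dini-regular, i.e. there is $C>0$ such that $$\int_0^x\log\frac1{W(t)}\,dt\le C\,x\log\frac1{W(x)}<\infty\qquad\text{for all sufficiently small } x>0.$$ Put $\kappa_W(t)=t\log\frac{1}{W(t)}$. A compact set $K\subset\partial\mathbb{D}$ with $m(K)=0$ is said to have finite $\kappa_W$-entropy if $\sum_k\kappa_W(m(I_k))<\infty$, where $(I_k)_k$ are the connected components of $\partial\mathbb{D}\setminus K$. Let $A^\infty(W)$ be the space of holomorphic functions $f$ on $\mathbb{D}$ with $\lim_{|z|\to1-}W(1-|z|)|f(z)|=0$, with the norm $\|f\|_{A^\infty(W)}=\sup_{z\in\mathbb{D}}W(1-|z|)|f(z)|$; a function $f\in A^\infty(W)$ is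 called cyclic if the linear span of $\{z^nf(z):n=0,1,2,\dots\}$ is dense in $A^\infty(W)$. Let $\mu$ be a positive finite Borel measure on $\partial\mathbb{D}$, singular with respect to $m$, such that $\mu(K)=0$ for every set $K\subset\partial\mathbb{D}$ of finite $\kappa_W$-entropy. Then the singular inner function $$\Theta_\mu(z)=\exp\left(-\int_{\partial\mathbb{D}}\frac{\zeta+z}{\zeta-z}\,d\mu(\zeta)\right),\qquad z\in\mathbb{D},$$ is cyclic in $A^\infty(W)$. -/

import Mathlib

open Filter Topology MeasureTheory Metric Set
open scoped ENNReal

noncomputable section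

namespace GrowthSpace

instance instMeasurableSpaceCircle : MeasurableSpace Circle := borel Circle

instance instBorelSpaceCircle : BorelSpace Circle := ⟨rfl⟩

/-- The unit-normalized Lebesgue (arc length) measure `m` on the unit circle. -/
def circleMeasure : Measure Circle :=
  Measure.map (fun θ : ℝ => Circle.exp (2 * Real.pi * θ)) (volume.restrict (Ioc 0 1))

/-- Good weights `W : (0,1] → (0,1]`; the values of `W` outside `(0,1]` play no role.
The doubling condition on `log (1/W)` is asked for near `0` only, so that the weights
`W t = t ^ α` (for which `log (1 / W 1) = 0`) qualify. -/
structure IsGoodWeight (W : ℝ → ℝ) : Prop where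
  mem_Ioc : ∀ t ∈ Ioc (0 : ℝ) 1, W t ∈ Ioc (0 : ℝ) 1
  continuousOn : ContinuousOn W (Ioc 0 1)
  monotoneOn : MonotoneOn W (Ioc 0 1)
  tendsto_zero : Tendsto W (𝓝[>] 0) (𝓝 0)
  doubling : ∃ C : ℝ, 1 < C ∧
    ∀ᶠ t in 𝓝[>] (0 : ℝ), Real.log (1 / W (t / 2)) ≤ C * Real.log (1 / W t)

/-- Dini-regularity of a weight: `log (1/W)` is integrable near `0` and
`∫₀ˣ log (1 / W t) dt ≤ C x log (1 / W x)` for all small `x > 0`. -/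
def IsDiniRegular (W : ℝ → ℝ) : Prop :=
  ∃ C : ℝ, 0 < C ∧ ∀ᶠ x in 𝓝[>] (0 : ℝ),
    IntegrableOn (fun t => Real.log (1 / W t)) (Ioc 0 x) ∧
      ∫ t in Ioc 0 x, Real.log (1 / W t) ≤ C * (x * Real.log (1 / W x))

/-- The gauge function `κ_W t = t log (1 / W t)`. -/
def gaugeFn (W : ℝ → ℝ) (t : ℝ) : ℝ := t * Real.log (1 / W t)

/-- The connected components of the complement of `K` in the unit circle. -/
def complementaryArcs (K : Set Circle) : Set (Set Circle) :=
  (fun x => connectedComponentIn Kᶜ x) '' Kᶜ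

/-- Compact sets of Lebesgue measure zero and of finite `κ_W`-entropy. Lengths are normalized
(the circle has length `1`), so that they lie in the domain `(0,1]` of `W`. -/
structure HasFiniteEntropy (W : ℝ → ℝ) (K : Set Circle) : Prop where
  isCompact : IsCompact K
  measure_zero : circleMeasure K = 0
  summable : Summable fun I : complementaryArcs K => gaugeFn W (circleMeasure.real (I : Set Circle))

/-- The singular inner function `Θ_μ z = exp (-∫ (ζ + z) / (ζ - z) dμ(ζ))`. -/
def singularInner (μ : Measure Circle) (z : ℂ) : ℂ :=
  Complex.exp (-∫ ζ : Circle, ((ζ : ℂ) + z) / ((ζ : ℂ) - z) ∂μ)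

/-- Membership in `A^∞(W)`: `f` is holomorphic in the open unit disc and
`W (1 - |z|) |f z| → 0` as `|z| → 1-`. Values of `f` outside the disc play no role. -/
structure MemGrowth (W : ℝ → ℝ) (f : ℂ → ℂ) : Prop where
  differentiableOn : DifferentiableOn ℂ f (ball 0 1)
  tendsto_zero :
    Tendsto (fun z : ℂ => W (1 - ‖z‖) * ‖f z‖) (comap (fun z : ℂ => ‖z‖) (𝓝[<] 1)) (𝓝 0)

/-- The norm of `A^∞(W)`, the supremum over the unit disc of `W (1 - |z|) |f z|`. -/
def growthNorm (W : ℝ → ℝ) (f : ℂ → ℂ) : ℝ≥0∞ :=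
  ⨆ z ∈ ball (0 : ℂ) 1, ENNReal.ofReal (W (1 - ‖z‖) * ‖f z‖)

/-- `f` is cyclic in `A^∞(W)`: `f` belongs to `A^∞(W)`, and the linear span of the functions
`z ^ n * f z`, `n = 0, 1, 2, …`, is dense in `A^∞(W)`. -/
def IsCyclicVector (W : ℝ → ℝ) (f : ℂ → ℂ) : Prop :=
  MemGrowth W f ∧
    ∀ g : ℂ → ℂ, MemGrowth W g → ∀ ε : ℝ≥0∞, 0 < ε →
      ∃ h ∈ Submodule.span ℂ (range fun (n : ℕ) (z : ℂ) => z ^ n * f z),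
        growthNorm W (h - g) < ε

end GrowthSpace

end

noncomputable section

namespace GrowthSpace

/-! Because the inner function is bounded by 1, cyclicity reduces to approximating the constant `1`
in the growth norm by its bounded multiples (`IsGoodWeight.isCyclicVector_of_approx_one`). Write L =
log (1/W).

The building block (`IsGoodWeight.exists_approx_inverse`) is a measure ν whose mass on each arc of
length δ = 1/N is at most c L(δ) δ. Harnack's inequality bounds 1/Θ_ν on |z| = 1 - δ by
exp(bL(δ)/8), where b is `gain C`. A de la Vallée Poussin mean f of the Taylor sums of 1/Θ_ν, of
order n about bL(δ)/(64δ), is then bounded on the whole disc by a constant times exp(bL(δ)/4). Since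
Θ_ν f - 1 vanishes at 0 beyond order n, the Schwarz lemma bounds it by a constant times exp(bL(δ)/4)
|z|^n. Doubling of L gives W(1-|z|) |z|^n ≤ exp(-bL(δ)), so the weighted error is at most a constant
times exp(-3bL(δ)/4).

A general μ is cut up along dyadic scales 1/N_k on which L_k = L(1/N_k) grows by a factor between 2
and 2C. At step k the mass of every arc is truncated at c L_k/N_k; the truncated part is a building
block, and the excess, carried by the heavy arcs, goes on to the next step. In the product of the
approximate inverses the earlier factors cost exp(b(L_0 + ... + L_{m-1})/4), hence at most
exp(bL_m/4) up to powers of a constant, which is less than the gain of the m-th factor; the errors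
therefore add up geometrically, uniformly in the number of factors
(`weight_mul_norm_prod_sub_one_le`).

It remains to exhaust μ. Each heavy arc uses up mass c L_k/N_k, so the sum over k of (number of
heavy arcs) L_k/N_k is finite. This is exactly what makes the limit set of the heavy arcs a set of
finite entropy (`IsGoodWeight.hasFiniteEntropy_iInter`). By hypothesis μ does not charge it, so the
residual masses tend to 0 (`IsGoodWeight.tendsto_residual`), and the inner function of a measure of
small mass is close to 1 in the growth norm. -/

/-! ### Bounded Taylor approximation -/

/-- Parseval's identity for geometric sums on the circle of radius `r`. -/
theorem circleAverage_norm_sq_geom_sum (a : ℂ) (r : ℝ) (N : ℕ) :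
    Real.circleAverage (fun ζ : ℂ => ‖∑ i ∈ Finset.range N, (a * ζ) ^ i‖ ^ 2) 0 r
      = ∑ i ∈ Finset.range N, (‖a‖ * |r|) ^ (2 * i) := by
  induction N with
  | zero => simp [Real.circleAverage_def]
  | succ N ih =>
    set S : ℂ → ℂ := fun ζ => ∑ i ∈ Finset.range N, (a * ζ) ^ i with hS
    have hSc : Continuous S := by fun_prop
    have hSd : Differentiable ℂ S := by fun_prop
    have hmean : Real.circleAverage (fun ζ : ℂ => a * ζ * S ζ) 0 r = 0 := by
      have h := DiffContOnCl.circleAverage (f := fun ζ : ℂ => a * ζ * S ζ) (c := 0) (R := r)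
        (Differentiable.diffContOnCl (by fun_prop))
      simpa using h
    have hre : Real.circleAverage (fun ζ : ℂ => (a * ζ * S ζ).re) 0 r = 0 := by
      have h := Complex.reCLM.circleAverage_comp_comm (f := fun ζ : ℂ => a * ζ * S ζ)
        (c := 0) (R := r) (ContinuousOn.circleIntegrable' (by fun_prop))
      rw [hmean] at h
      simpa [Function.comp_def] using h
    -- The sum of length N + 1 equals 1 + aζS(ζ); the cross term has mean zero because aζS(ζ)
    -- vanishes at the origin.
    have hexp : ∀ ζ ∈ sphere (0 : ℂ) |r|,
        ‖∑ i ∈ Finset.range (N + 1), (a * ζ) ^ i‖ ^ 2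
          = (1 + 2 * (a * ζ * S ζ).re) + (‖a‖ * |r|) ^ 2 * ‖S ζ‖ ^ 2 := by
      intro ζ hζ
      have hζ' : ‖ζ‖ = |r| := by simpa using hζ
      have h1 : ∑ i ∈ Finset.range (N + 1), (a * ζ) ^ i = 1 + a * ζ * S ζ := by
        rw [Finset.sum_range_succ', hS, Finset.mul_sum, add_comm]
        simp [pow_succ']
      rw [h1, ← hζ', ← norm_mul, ← mul_pow, ← norm_mul, ← Complex.normSq_eq_norm_sq,
        ← Complex.normSq_eq_norm_sq, Complex.normSq_add]
      simp
      ring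
    rw [Real.circleAverage_congr_sphere hexp, Real.circleAverage_fun_add,
      Real.circleAverage_fun_add]
    · have h2 : Real.circleAverage (fun ζ : ℂ => 2 * (a * ζ * S ζ).re) 0 r = 0 := by
        have := Real.circleAverage_fun_smul (a := (2 : ℝ)) (f := fun ζ : ℂ => (a * ζ * S ζ).re)
          (c := 0) (R := r)
        simp only [smul_eq_mul] at this
        rw [this, hre, mul_zero]
      have h3 : Real.circleAverage (fun ζ : ℂ => (‖a‖ * |r|) ^ 2 * ‖S ζ‖ ^ 2) 0 r
          = (‖a‖ * |r|) ^ 2 * ∑ i ∈ Finset.range N, (‖a‖ * |r|) ^ (2 * i) := by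
        have := Real.circleAverage_fun_smul (a := (‖a‖ * |r|) ^ 2) (f := fun ζ : ℂ => ‖S ζ‖ ^ 2)
          (c := 0) (R := r)
        rw [ih] at this
        simpa using this
      rw [h2, h3, Real.circleAverage_const, Finset.sum_range_succ', Finset.mul_sum]
      simp only [mul_add, pow_add, mul_one, mul_zero, pow_zero, add_zero]
      rw [add_comm]
      congr 1
      exact Finset.sum_congr rfl fun i _ => mul_comm _ _
    all_goals exact ContinuousOn.circleIntegrable' (by fun_prop)

theorem cauchyPowerSeries_apply_eq_circleAverage (h : ℂ → ℂ) {r : ℝ} (hr : 0 < r) (k : ℕ)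
    (z : ℂ) :
    cauchyPowerSeries h 0 r k (fun _ => z)
      = Real.circleAverage (fun ζ : ℂ => (z / ζ) ^ k * h ζ) 0 r := by
  rw [cauchyPowerSeries_apply, Real.circleAverage_eq_circleIntegral hr.ne']
  congr 1
  refine circleIntegral.integral_congr hr.le fun ζ _ => ?_
  simp only [sub_zero, smul_eq_mul]
  ring

/-- The mean of the Taylor partial sums of `h` of orders `n + 1, …, 2 n`. -/
def delayedMean (h : ℂ → ℂ) (r : ℝ) (n : ℕ) (z : ℂ) : ℂ :=
  (n : ℂ)⁻¹ * ∑ j ∈ Finset.range n, (cauchyPowerSeries h 0 r).partialSum (2 * n - j) z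

theorem differentiable_delayedMean (h : ℂ → ℂ) (r : ℝ) (n : ℕ) :
    Differentiable ℂ (delayedMean h r n) := by
  have : ∀ k, Differentiable ℂ fun z => cauchyPowerSeries h 0 r k (fun _ => z) := by
    intro k
    have e : (fun z : ℂ => cauchyPowerSeries h 0 r k (fun _ => z))
        = fun z => z ^ k * cauchyPowerSeries h 0 r k (fun _ => 1) := by
      ext z
      rw [FormalMultilinearSeries.apply_eq_pow_smul_coeff]
      rfl
    rw [e]
    fun_prop
  unfold delayedMean FormalMultilinearSeries.partialSum
  fun_prop

/-- Every partial sum in the mean has order at least n + 1, so each reproduces the Taylor series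
through degree n. -/
theorem delayedMean_sub_isLittleO {h : ℂ → ℂ} {r : ℝ} (hr : 0 < r)
    (hh : DifferentiableOn ℂ h (closedBall 0 r)) {n : ℕ} (hn : 0 < n) :
    (fun z => h z - delayedMean h r n z) =o[𝓝 0] fun z : ℂ => ‖z‖ ^ n := by
  lift r to NNReal using hr.le
  have hp : HasFPowerSeriesOnBall h (cauchyPowerSeries h 0 r) 0 r :=
    hh.hasFPowerSeriesOnBall (by exact_mod_cast hr)
  have hO : ∀ j ∈ Finset.range n,
      (fun z => h z - (cauchyPowerSeries h 0 r).partialSum (2 * n - j) z)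
        =o[𝓝 0] fun z : ℂ => ‖z‖ ^ n := by
    intro j hj
    have hj' : n < 2 * n - j := by have := Finset.mem_range.1 hj; omega
    have h1 := hp.hasFPowerSeriesAt.isBigO_sub_partialSum_pow (2 * n - j)
    simp only [zero_add] at h1
    exact h1.trans_isLittleO ((Asymptotics.isLittleO_pow_pow hj').comp_tendsto tendsto_norm_zero)
  have hs := (Asymptotics.IsLittleO.sum hO).const_mul_left ((n : ℂ)⁻¹)
  refine hs.congr_left fun z => ?_
  have hn' : (n : ℂ) ≠ 0 := by exact_mod_cast hn.ne'
  simp only [delayedMean, Finset.sum_apply, Finset.sum_sub_distrib, Finset.sum_const, Finset.card_range,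
    nsmul_eq_mul, mul_sub]
  field_simp

/-- Multiplying the geometric kernel by (ζ/z)^j shifts its powers of z down by j; the resulting
negative powers integrate to zero against the holomorphic h. All the partial sums in a delayed mean
thus share one kernel, and averaging over j turns it into a product of two geometric sums. -/
theorem partialSum_eq_circleAverage {h : ℂ → ℂ} {r : ℝ} (hr : 0 < r)
    (hh : DifferentiableOn ℂ h (closedBall 0 r)) {z : ℂ} (hz : z ≠ 0) {N j : ℕ} (hj : j ≤ N) :
    (cauchyPowerSeries h 0 r).partialSum (N - j) z
      = Real.circleAverage
          (fun ζ : ℂ => (∑ i ∈ Finset.range N, (z / ζ) ^ i) * (ζ / z) ^ j * h ζ) 0 r := by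
  have hc : ContinuousOn h (sphere 0 |r|) := by
    rw [abs_of_pos hr]; exact hh.continuousOn.mono sphere_subset_closedBall
  have hne : ∀ ζ ∈ sphere (0 : ℂ) |r|, ζ ≠ 0 := fun ζ hζ h0 => by
    rw [h0] at hζ; simp [abs_of_pos hr, hr.ne] at hζ
  have hterm : ∀ i, CircleIntegrable (fun ζ : ℂ => (z / ζ) ^ i * (ζ / z) ^ j * h ζ) 0 r := by
    intro i
    refine ContinuousOn.circleIntegrable' (ContinuousOn.mul (ContinuousOn.mul ?_ ?_) hc)
    · exact (continuousOn_const.div continuousOn_id hne).pow i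
    · fun_prop
  have hlow : ∀ i < j,
      Real.circleAverage (fun ζ : ℂ => (z / ζ) ^ i * (ζ / z) ^ j * h ζ) 0 r = 0 := by
    intro i hi
    have hcongr : ∀ ζ ∈ sphere (0 : ℂ) |r|,
        (z / ζ) ^ i * (ζ / z) ^ j * h ζ = (ζ / z) ^ (j - i) * h ζ := by
      intro ζ hζ
      have := hne ζ hζ
      obtain ⟨d, rfl⟩ := Nat.exists_eq_add_of_lt hi
      rw [show i + d + 1 - i = d + 1 by omega, show i + d + 1 = i + (d + 1) by omega, pow_add,
        ← mul_assoc, ← mul_pow, div_mul_div_cancel₀ this, div_self hz, one_pow, one_mul]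
    rw [Real.circleAverage_congr_sphere hcongr]
    have := DiffContOnCl.circleAverage (f := fun ζ : ℂ => (ζ / z) ^ (j - i) * h ζ) (c := 0)
      (R := r) (DifferentiableOn.diffContOnCl (by
        rw [abs_of_pos hr, closure_ball _ hr.ne']
        exact DifferentiableOn.mul (by fun_prop) hh))
    rw [this, zero_div, zero_pow (by omega), zero_mul]
  have hhigh : ∀ k, Real.circleAverage (fun ζ : ℂ => (z / ζ) ^ (j + k) * (ζ / z) ^ j * h ζ) 0 r
      = cauchyPowerSeries h 0 r k (fun _ => z) := by
    intro k
    rw [cauchyPowerSeries_apply_eq_circleAverage h hr]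
    refine Real.circleAverage_congr_sphere fun ζ hζ => ?_
    have := hne ζ hζ
    rw [pow_add, mul_right_comm ((z / ζ) ^ j), ← mul_pow, div_mul_div_cancel₀ this,
      div_self hz, one_pow, one_mul]
  have hsum : (fun ζ : ℂ => (∑ i ∈ Finset.range N, (z / ζ) ^ i) * (ζ / z) ^ j * h ζ)
      = fun ζ => ∑ i ∈ Finset.range N, (z / ζ) ^ i * (ζ / z) ^ j * h ζ := by
    ext ζ; rw [Finset.sum_mul, Finset.sum_mul]
  rw [hsum, Real.circleAverage_fun_sum fun i _ => hterm i]
  obtain ⟨d, rfl⟩ := Nat.exists_eq_add_of_le hj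
  rw [Finset.sum_range_add, Finset.sum_eq_zero fun i hi => hlow i (Finset.mem_range.1 hi),
    zero_add, Nat.add_sub_cancel_left, FormalMultilinearSeries.partialSum]
  exact Finset.sum_congr rfl fun k _ => (hhigh k).symm

/-- The kernel is a product AB of two geometric sums, so 2|AB| ≤ |A|² + |B|² and Parseval bound its
mean modulus by a multiple of n, which the factor 1/n cancels. Having no factor that grows with n
beyond r^(-4n) matters: for slowly growing log (1/W), even log n could not be absorbed later. -/
theorem norm_delayedMean_le_of_norm_eq_one {h : ℂ → ℂ} {r M : ℝ} (hr : 0 < r) (hr1 : r ≤ 1)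
    (hh : DifferentiableOn ℂ h (closedBall 0 r)) (hM : ∀ z ∈ sphere (0 : ℂ) r, ‖h z‖ ≤ M)
    {n : ℕ} (hn : 0 < n) {z : ℂ} (hz : ‖z‖ = 1) :
    ‖delayedMean h r n z‖ ≤ 3 / 2 * r⁻¹ ^ (4 * n) * M := by
  have hz0 : z ≠ 0 := by rintro rfl; simp at hz
  have hnR : (0 : ℝ) < n := by exact_mod_cast hn
  have hM0 : 0 ≤ M := by
    have := hM (r : ℂ) (by simp [abs_of_pos hr])
    exact (norm_nonneg _).trans this
  have hc : ContinuousOn h (sphere 0 |r|) := by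
    rw [abs_of_pos hr]; exact hh.continuousOn.mono sphere_subset_closedBall
  have hne : ∀ ζ ∈ sphere (0 : ℂ) |r|, ζ ≠ 0 := fun ζ hζ h0 => by
    rw [h0] at hζ; simp [abs_of_pos hr, hr.ne] at hζ
  set A : ℂ → ℂ := fun ζ => ∑ i ∈ Finset.range (2 * n), (z / ζ) ^ i with hA
  -- On |ζ| = r the conjugate of z/ζ is a multiple of ζ, so A has the modulus of a polynomial in ζ
  -- to which Parseval applies.
  set A' : ℂ → ℂ := fun ζ => ∑ i ∈ Finset.range (2 * n), (starRingEnd ℂ z / r ^ 2 * ζ) ^ i with hA'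
  set B : ℂ → ℂ := fun ζ => ∑ j ∈ Finset.range n, (z⁻¹ * ζ) ^ j with hB
  have hAc : ContinuousOn A (sphere 0 |r|) :=
    continuousOn_finsetSum _ fun i _ => (continuousOn_const.div continuousOn_id hne).pow i
  have hA'c : Continuous A' := by fun_prop
  have hBc : Continuous B := by fun_prop
  have hAA' : ∀ ζ ∈ sphere (0 : ℂ) |r|, ‖A ζ‖ = ‖A' ζ‖ := by
    intro ζ hζ
    have h0 := hne ζ hζ
    have hζr : ‖ζ‖ = r := by simpa [abs_of_pos hr] using hζ
    have hcz : starRingEnd ℂ ζ = r ^ 2 / ζ := by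
      rw [eq_div_iff h0, mul_comm, Complex.mul_conj, Complex.normSq_eq_norm_sq, hζr]; simp
    rw [← RCLike.norm_conj (A ζ)]
    congr 1
    simp only [hA, hA', map_sum, map_pow, map_div₀, hcz]
    refine Finset.sum_congr rfl fun i _ => ?_
    congr 1
    have : (r : ℂ) ≠ 0 := by exact_mod_cast hr.ne'
    field_simp
  have hrep : delayedMean h r n z
      = (n : ℂ)⁻¹ * Real.circleAverage (fun ζ => A ζ * B ζ * h ζ) 0 r := by
    have hterm : ∀ j, CircleIntegrable (fun ζ : ℂ => A ζ * (ζ / z) ^ j * h ζ) 0 r := fun j =>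
      ContinuousOn.circleIntegrable' ((hAc.mul (by fun_prop)).mul hc)
    rw [delayedMean]
    congr 1
    rw [Finset.sum_congr rfl fun j hj => partialSum_eq_circleAverage hr hh hz0
      (N := 2 * n) (j := j) (by have := Finset.mem_range.1 hj; omega),
      ← Real.circleAverage_fun_sum fun j _ => hterm j]
    congr 1
    ext ζ
    rw [hB, Finset.mul_sum, Finset.sum_mul]
    refine Finset.sum_congr rfl fun j _ => ?_
    rw [div_eq_inv_mul]
  have hnorm : ‖Real.circleAverage (fun ζ => A ζ * B ζ * h ζ) 0 r‖
      ≤ Real.circleAverage (fun ζ => M / 2 * (‖A' ζ‖ ^ 2 + ‖B ζ‖ ^ 2)) 0 r := by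
    calc ‖Real.circleAverage (fun ζ => A ζ * B ζ * h ζ) 0 r‖
        ≤ Real.circleAverage (fun ζ => ‖A ζ * B ζ * h ζ‖) 0 r := by
          rw [Real.circleAverage_def, Real.circleAverage_def, norm_smul, smul_eq_mul,
            Real.norm_of_nonneg (by positivity)]
          gcongr
          exact intervalIntegral.norm_integral_le_integral_norm (by positivity)
      _ ≤ _ := by
          refine Real.circleAverage_mono ?_ ?_ fun ζ hζ => ?_
          · exact ContinuousOn.circleIntegrable' ((hAc.mul hBc.continuousOn).mul hc).norm
          · exact ContinuousOn.circleIntegrable' (by fun_prop)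
          · rw [norm_mul, norm_mul, hAA' ζ hζ]
            have h1 := hM ζ (by rwa [abs_of_pos hr] at hζ)
            have h2 := mul_le_mul_of_nonneg_left h1
              (mul_nonneg (norm_nonneg (A' ζ)) (norm_nonneg (B ζ)))
            nlinarith [mul_nonneg hM0 (sq_nonneg (‖A' ζ‖ - ‖B ζ‖))]
  have hval : Real.circleAverage (fun ζ => M / 2 * (‖A' ζ‖ ^ 2 + ‖B ζ‖ ^ 2)) 0 r
      = M / 2 * (∑ i ∈ Finset.range (2 * n), r⁻¹ ^ (2 * i) + ∑ j ∈ Finset.range n, r ^ (2 * j)) := by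
    have e := Real.circleAverage_fun_smul (a := M / 2) (f := fun ζ => ‖A' ζ‖ ^ 2 + ‖B ζ‖ ^ 2)
      (c := 0) (R := r)
    simp only [smul_eq_mul] at e
    rw [e, Real.circleAverage_fun_add (ContinuousOn.circleIntegrable' (by fun_prop))
      (ContinuousOn.circleIntegrable' (by fun_prop)), circleAverage_norm_sq_geom_sum,
      circleAverage_norm_sq_geom_sum]
    congr 3
    · ext i
      congr 1
      rw [norm_div, RCLike.norm_conj, hz, abs_of_pos hr]
      simp [abs_of_pos hr]
      field_simp
    · ext i
      rw [norm_inv, hz, abs_of_pos hr, inv_one, one_mul]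
  have hr1' : 1 ≤ r⁻¹ := (one_le_inv₀ hr).2 hr1
  have hs1 : ∑ i ∈ Finset.range (2 * n), r⁻¹ ^ (2 * i) ≤ (2 * n) * r⁻¹ ^ (4 * n) := by
    have := Finset.sum_le_card_nsmul (Finset.range (2 * n)) (fun i => r⁻¹ ^ (2 * i))
      (r⁻¹ ^ (4 * n)) fun i hi => pow_le_pow_right₀ hr1'
        (by have := Finset.mem_range.1 hi; omega)
    simpa using this
  have hs2 : ∑ j ∈ Finset.range n, r ^ (2 * j) ≤ n * r⁻¹ ^ (4 * n) := by
    have := Finset.sum_le_card_nsmul (Finset.range n) (fun i => r ^ (2 * i))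
      (r⁻¹ ^ (4 * n)) fun i _ => (pow_le_one₀ hr.le hr1).trans (one_le_pow₀ hr1')
    simpa using this
  rw [hrep, norm_mul, norm_inv, Complex.norm_natCast]
  calc (n : ℝ)⁻¹ * ‖Real.circleAverage (fun ζ => A ζ * B ζ * h ζ) 0 r‖
      ≤ (n : ℝ)⁻¹ * (M / 2 * ((2 * n) * r⁻¹ ^ (4 * n) + n * r⁻¹ ^ (4 * n))) := by
        gcongr
        rw [hval] at hnorm
        refine hnorm.trans ?_
        gcongr
    _ = 3 / 2 * r⁻¹ ^ (4 * n) * M := by field_simp; ring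

theorem norm_delayedMean_le {h : ℂ → ℂ} {r M : ℝ} (hr : 0 < r) (hr1 : r ≤ 1)
    (hh : DifferentiableOn ℂ h (closedBall 0 r)) (hM : ∀ z ∈ sphere (0 : ℂ) r, ‖h z‖ ≤ M)
    {n : ℕ} (hn : 0 < n) {z : ℂ} (hz : z ∈ ball (0 : ℂ) 1) :
    ‖delayedMean h r n z‖ ≤ 3 / 2 * r⁻¹ ^ (4 * n) * M := by
  refine Complex.norm_le_of_forall_mem_frontier_norm_le isBounded_ball
    (differentiable_delayedMean h r n).diffContOnCl (fun w hw => ?_) (subset_closure hz)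
  rw [frontier_ball _ one_ne_zero] at hw
  exact norm_delayedMean_le_of_norm_eq_one hr hr1 hh hM hn (by simpa using hw)

/-- If `Θ` is bounded by `1` in the unit disc and `|1 / Θ| ≤ M` on the circle of radius `r`, then
`Θ` has a bounded approximate inverse to order `n` at the origin. -/
theorem exists_bounded_approx_inverse {Θ : ℂ → ℂ} (hΘ : DifferentiableOn ℂ Θ (ball 0 1))
    (hΘ1 : ∀ z ∈ ball (0 : ℂ) 1, ‖Θ z‖ ≤ 1) (hΘ0 : ∀ z ∈ ball (0 : ℂ) 1, Θ z ≠ 0)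
    {r M : ℝ} (hr : 0 < r) (hr1 : r < 1) (hM : ∀ z ∈ sphere (0 : ℂ) r, ‖(Θ z)⁻¹‖ ≤ M)
    {n : ℕ} (hn : 0 < n) :
    ∃ f : ℂ → ℂ, Differentiable ℂ f ∧
      (∀ z ∈ ball (0 : ℂ) 1, ‖f z‖ ≤ 3 / 2 * r⁻¹ ^ (4 * n) * M) ∧
      ∀ z ∈ ball (0 : ℂ) 1,
        ‖Θ z * f z - 1‖ ≤ (1 + 3 / 2 * r⁻¹ ^ (4 * n) * M) * ‖z‖ ^ n := by
  set B := 3 / 2 * r⁻¹ ^ (4 * n) * M with hB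
  have hsub : closedBall (0 : ℂ) r ⊆ ball 0 1 := closedBall_subset_ball hr1
  have hinv : DifferentiableOn ℂ (fun z => (Θ z)⁻¹) (closedBall 0 r) :=
    (hΘ.mono hsub).inv fun z hz => hΘ0 z (hsub hz)
  set f := delayedMean (fun z => (Θ z)⁻¹) r n with hf
  have hfd : Differentiable ℂ f := differentiable_delayedMean _ r n
  have hfB : ∀ z ∈ ball (0 : ℂ) 1, ‖f z‖ ≤ B := fun z hz =>
    norm_delayedMean_le hr hr1.le hinv hM hn hz
  refine ⟨f, hfd, hfB, fun z hz => ?_⟩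
  have h01 : (0 : ℂ) ∈ ball (0 : ℂ) 1 := by simp
  have hlo := delayedMean_sub_isLittleO hr hinv hn
  have hlo' : (fun z => Θ z * f z - 1) =o[𝓝 0] fun z : ℂ => ‖z‖ ^ n := by
    have hbdd : Θ =O[𝓝 0] fun _ => (1 : ℝ) :=
      (((hΘ 0 h01).differentiableAt (isOpen_ball.mem_nhds h01)).continuousAt).isBigO_one ℝ
    have h1 := (hbdd.mul_isLittleO hlo).neg_left
    simp only [one_mul] at h1
    refine h1.congr' ?_ EventuallyEq.rfl
    filter_upwards [isOpen_ball.mem_nhds h01] with w hw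
    have := hΘ0 w hw
    rw [hf]
    field_simp
    ring
  have hzero : Θ 0 * f 0 - 1 = 0 := by
    have h1 : ContinuousAt (fun z => Θ z * f z - 1) 0 := by
      have := ((hΘ 0 h01).differentiableAt (isOpen_ball.mem_nhds h01)).continuousAt
      exact (this.mul hfd.continuous.continuousAt).sub continuousAt_const
    have h2 : Tendsto (fun z : ℂ => ‖z‖ ^ n) (𝓝 0) (𝓝 0) := by
      have : Continuous fun z : ℂ => ‖z‖ ^ n := by fun_prop
      simpa [hn.ne'] using this.tendsto 0
    exact tendsto_nhds_unique h1 (hlo'.trans_tendsto h2)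
  -- Schwarz lemma of higher order: a function bounded by 1 + B that is o(|z|^n) at 0 is at most (1
  -- + B)|z|^(n+1).
  have hmain := Complex.dist_le_mul_div_pow_of_mapsTo_ball_of_isLittleO
    (f := fun z => Θ z * f z - 1) (c := 0) (z := z) (R₁ := 1) (R₂ := 1 + B) (n := n)
    ((hΘ.mul hfd.differentiableOn).sub_const 1)
    (fun w hw => by
      simp only [hzero, mem_closedBall_zero_iff]
      calc ‖Θ w * f w - 1‖ ≤ ‖Θ w‖ * ‖f w‖ + 1 := by
            simpa using norm_sub_le (Θ w * f w) 1
        _ ≤ 1 * B + 1 := by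
            gcongr
            · exact hΘ1 w hw
            · exact hfB w hw
        _ = 1 + B := by ring)
    (by simpa [hzero] using hlo') hz
  have hB0 : 0 ≤ B := (norm_nonneg _).trans (hfB 0 h01)
  have hz1 : ‖z‖ ≤ 1 := by simpa using (mem_ball_zero_iff.1 hz).le
  simp only [hzero, dist_zero_right, div_one] at hmain
  refine hmain.trans ?_
  gcongr ?_ * ?_
  exact pow_le_pow_of_le_one (norm_nonneg _) hz1 n.le_succ

/-! ### Arcs of the circle -/

/-- The parametrization of the circle by the normalized angle. -/
def circleParam (θ : ℝ) : Circle := Circle.exp (2 * Real.pi * θ)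

theorem continuous_circleParam : Continuous circleParam := by
  unfold circleParam; fun_prop

theorem isOpenMap_circleParam : IsOpenMap circleParam := by
  have h := (Homeomorph.mulLeft₀ (2 * Real.pi) Real.two_pi_pos.ne').isOpenMap
  exact isLocalHomeomorph_circleExp.isOpenMap.comp h

theorem injOn_circleParam : InjOn circleParam (Ioc 0 1) := by
  intro x hx y hy hxy
  have h := Circle.exp_injOn_Ioc (a := 0) (b := 2 * Real.pi) (by simp)
    (x₁ := 2 * Real.pi * x) (x₂ := 2 * Real.pi * y)
  have hp := Real.two_pi_pos
  have := h ⟨by have := hx.1; positivity, by nlinarith [hx.2]⟩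
    ⟨by have := hy.1; positivity, by nlinarith [hy.2]⟩ hxy
  exact mul_left_cancel₀ hp.ne' this

theorem exists_circleParam_eq (x : Circle) : ∃ θ ∈ Ioc (0 : ℝ) 1, circleParam θ = x := by
  have hp := Real.two_pi_pos
  obtain ⟨t, rfl⟩ := Circle.exp_surjective x
  obtain ⟨y, hy, hty⟩ := Circle.periodic_exp.exists_mem_Ioc hp t 0
  refine ⟨y / (2 * Real.pi), ⟨by have := hy.1; positivity, ?_⟩, ?_⟩
  · rw [div_le_one hp]; simpa using hy.2
  · rw [circleParam, mul_div_cancel₀ _ hp.ne', hty]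

/-- The `j`-th arc of the subdivision of the circle into `N` arcs of equal length. -/
def arc (N j : ℕ) : Set Circle := circleParam '' Ioc (j / N : ℝ) ((j + 1) / N)

theorem Ioc_div_subset {N j : ℕ} (hj : j < N) :
    Ioc (j / N : ℝ) ((j + 1) / N) ⊆ Ioc 0 1 := by
  have hN : (0 : ℝ) < N := by exact_mod_cast (by omega : 0 < N)
  refine Ioc_subset_Ioc (by positivity) ?_
  rw [div_le_one hN]
  exact_mod_cast hj

theorem measurableSet_arc {N j : ℕ} (hj : j < N) : MeasurableSet (arc N j) :=
  measurableSet_Ioc.image_of_continuousOn_injOn continuous_circleParam.continuousOn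
    (injOn_circleParam.mono (Ioc_div_subset hj))

theorem measurable_circleParam : Measurable circleParam := continuous_circleParam.measurable

theorem circleMeasure_eq_map :
    circleMeasure = Measure.map circleParam (volume.restrict (Ioc 0 1)) := rfl

instance isProbabilityMeasure_circleMeasure : IsProbabilityMeasure circleMeasure := by
  rw [circleMeasure_eq_map]
  have : IsProbabilityMeasure ((volume : Measure ℝ).restrict (Ioc 0 1)) := ⟨by simp⟩
  exact Measure.isProbabilityMeasure_map measurable_circleParam.aemeasurable

theorem circleMeasure_arc {N j : ℕ} (hj : j < N) : circleMeasure (arc N j) = (N : ℝ≥0∞)⁻¹ := by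
  have hN : (0 : ℝ) < N := by exact_mod_cast (by omega : 0 < N)
  rw [circleMeasure_eq_map, Measure.map_apply measurable_circleParam (measurableSet_arc hj),
    Measure.restrict_apply (measurable_circleParam (measurableSet_arc hj)), arc,
    injOn_circleParam.preimage_image_inter (Ioc_div_subset hj), Real.volume_Ioc, add_div,
    add_sub_cancel_left, one_div, ENNReal.ofReal_inv_of_pos hN, ENNReal.ofReal_natCast]

theorem circleMeasure_real_arc {N j : ℕ} (hj : j < N) :
    circleMeasure.real (arc N j) = (N : ℝ)⁻¹ := by
  simp [Measure.real, circleMeasure_arc hj]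

theorem exists_mem_arc {N : ℕ} (hN : 0 < N) (x : Circle) : ∃ j < N, x ∈ arc N j := by
  obtain ⟨θ, hθ, rfl⟩ := exists_circleParam_eq x
  have hN' : (0 : ℝ) < N := by exact_mod_cast hN
  have hpos : 0 < θ * N := mul_pos hθ.1 hN'
  have hc : 0 < ⌈θ * N⌉₊ := Nat.ceil_pos.2 hpos
  have hle : ⌈θ * N⌉₊ ≤ N := Nat.ceil_le.2 (by nlinarith [hθ.2])
  -- The arcs are open on the left and closed on the right, so the index is the ceiling minus one
  -- rather than the floor.
  refine ⟨⌈θ * N⌉₊ - 1, by omega, θ, ⟨?_, ?_⟩, rfl⟩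
  · rw [div_lt_iff₀ hN', ← Nat.lt_ceil]
    omega
  · rw [le_div_iff₀ hN', Nat.cast_sub hc]
    simpa using Nat.le_ceil (θ * N)

theorem disjoint_arc {N i j : ℕ} (hi : i < N) (hj : j < N) (hij : i ≠ j) :
    Disjoint (arc N i) (arc N j) := by
  have hN : (0 : ℝ) < N := by exact_mod_cast (by omega : 0 < N)
  rw [disjoint_left]
  rintro _ ⟨s, hs, rfl⟩ ⟨t, ht, hst⟩
  obtain rfl := injOn_circleParam (Ioc_div_subset hj ht) (Ioc_div_subset hi hs) hst
  have h1 : (i : ℝ) < j + 1 := (div_lt_div_iff_of_pos_right hN).1 (hs.1.trans_le ht.2)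
  have h2 : (j : ℝ) < i + 1 := (div_lt_div_iff_of_pos_right hN).1 (ht.1.trans_le hs.2)
  norm_cast at h1 h2
  omega

theorem arc_mul_subset (N d j : ℕ) (hd : 0 < d) : arc (N * d) j ⊆ arc N (j / d) := by
  rcases Nat.eq_zero_or_pos N with rfl | hN
  · simp [arc]
  have hN' : (0 : ℝ) < N := by exact_mod_cast hN
  have hd' : (0 : ℝ) < d := by exact_mod_cast hd
  refine image_mono (Ioc_subset_Ioc ?_ ?_)
  · rw [div_le_div_iff₀ hN' (by positivity)]
    have : ((j / d : ℕ) : ℝ) * d ≤ j := by exact_mod_cast Nat.div_mul_le_self j d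
    push_cast
    nlinarith
  · rw [div_le_div_iff₀ (by positivity) hN']
    have : (j : ℝ) + 1 ≤ (((j / d : ℕ) : ℝ) + 1) * d := by
      exact_mod_cast Nat.lt_mul_of_div_lt (Nat.lt_succ_self _) hd
    push_cast
    nlinarith

theorem norm_circleParam_sub_le (s t : ℝ) :
    ‖(circleParam s : ℂ) - circleParam t‖ ≤ 2 * Real.pi * |s - t| := by
  have h := Real.norm_exp_I_mul_ofReal_sub_one_le (x := 2 * Real.pi * (s - t))
  have e : (circleParam s : ℂ) - circleParam t
      = circleParam t * (Complex.exp (Complex.I * (2 * Real.pi * (s - t) : ℝ)) - 1) := by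
    simp only [circleParam, Circle.coe_exp]
    rw [mul_sub, mul_one, ← Complex.exp_add]
    congr 2
    push_cast
    ring
  rw [e, norm_mul, Circle.norm_coe, one_mul]
  refine h.trans_eq ?_
  rw [norm_mul, Real.norm_of_nonneg Real.two_pi_pos.le, Real.norm_eq_abs]

theorem norm_sub_le_of_mem_arc {N j : ℕ} {x y : Circle} (hx : x ∈ arc N j) (hy : y ∈ arc N j) :
    ‖(x : ℂ) - y‖ ≤ 2 * Real.pi / N := by
  obtain ⟨s, hs, rfl⟩ := hx
  obtain ⟨t, ht, rfl⟩ := hy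
  refine (norm_circleParam_sub_le s t).trans ?_
  rw [div_eq_mul_inv]
  have : |s - t| ≤ (N : ℝ)⁻¹ := by
    rw [abs_le]
    have e : ((j : ℝ) + 1) / N = j / N + (N : ℝ)⁻¹ := by rw [add_div, one_div]
    constructor <;> linarith [hs.1, hs.2, ht.1, ht.2]
  have := Real.pi_pos
  gcongr

/-- An arc of the subdivision and its left neighbour cover the closure of the arc. -/
theorem exists_closure_arc_subset {N j : ℕ} (hj : j < N) :
    ∃ i < N, closure (arc N j) ⊆ arc N j ∪ arc N i := by
  obtain ⟨i, hi, hmem⟩ := exists_mem_arc (by omega : 0 < N) (circleParam (j / N))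
  refine ⟨i, hi, ?_⟩
  have hN : (0 : ℝ) < N := by exact_mod_cast (by omega : 0 < N)
  have h1 : closure (arc N j) ⊆ circleParam '' Icc (j / N : ℝ) ((j + 1) / N) :=
    closure_minimal (image_mono Ioc_subset_Icc_self)
      (isCompact_Icc.image continuous_circleParam).isClosed
  refine h1.trans ?_
  rintro _ ⟨t, ht, rfl⟩
  rcases ht.1.eq_or_lt with h | h
  · right; rwa [← h]
  · left; exact ⟨t, ⟨h, ht.2⟩, rfl⟩

theorem sum_integral_arc {N : ℕ} (hN : 0 < N) (ν : Measure Circle) {f : Circle → ℝ}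
    (hf : Integrable f ν) :
    ∑ j ∈ Finset.range N, ∫ x in arc N j, f x ∂ν = ∫ x, f x ∂ν := by
  rw [← integral_biUnion_finset]
  · rw [← setIntegral_univ (μ := ν)]
    congr 2
    refine eq_univ_of_forall fun x => ?_
    obtain ⟨j, hj, hx⟩ := exists_mem_arc hN x
    exact mem_biUnion (Finset.mem_coe.2 (Finset.mem_range.2 hj)) hx
  · exact fun j hj => measurableSet_arc (Finset.mem_range.1 hj)
  · intro i hi j hj hij
    exact disjoint_arc (by simpa using hi) (by simpa using hj) hij
  · exact fun j _ => hf.integrableOn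

/-! ### Singular inner functions -/

theorem coe_sub_ne_zero {z : ℂ} (hz : z ∈ ball (0 : ℂ) 1) (ζ : Circle) : (ζ : ℂ) - z ≠ 0 := by
  intro h
  rw [mem_ball_zero_iff, ← sub_eq_zero.1 h, Circle.norm_coe] at hz
  exact lt_irrefl _ hz

theorem one_sub_norm_le (z : ℂ) (ζ : Circle) : 1 - ‖z‖ ≤ ‖(ζ : ℂ) - z‖ := by
  have := norm_sub_norm_le (ζ : ℂ) z
  rwa [Circle.norm_coe] at this

theorem continuous_herglotz {z : ℂ} (hz : z ∈ ball (0 : ℂ) 1) :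
    Continuous fun ζ : Circle => ((ζ : ℂ) + z) / ((ζ : ℂ) - z) :=
  Continuous.div (by fun_prop) (by fun_prop) (coe_sub_ne_zero hz)

theorem integrable_of_continuous {E : Type*} [NormedAddCommGroup E] (μ : Measure Circle)
    [IsFiniteMeasure μ] {f : Circle → E} (hf : Continuous f) : Integrable f μ := by
  rw [← integrableOn_univ]
  exact hf.continuousOn.integrableOn_compact isCompact_univ

/-- The Poisson kernel of the unit disc. -/
def poisson (z : ℂ) (ζ : Circle) : ℝ := (((ζ : ℂ) + z) / ((ζ : ℂ) - z)).re

theorem continuous_poisson {z : ℂ} (hz : z ∈ ball (0 : ℂ) 1) : Continuous (poisson z) :=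
  Complex.continuous_re.comp (continuous_herglotz hz)

theorem poisson_eq (z : ℂ) (ζ : Circle) :
    poisson z ζ = (1 - ‖z‖ ^ 2) / ‖(ζ : ℂ) - z‖ ^ 2 := by
  have h := congrFun (poissonKernel_eq_re_herglotzRieszKernel (c := 0) (w := z)) (ζ : ℂ)
  simp only [Function.comp_apply, poissonKernel, herglotzRieszKernel, sub_zero,
    Circle.norm_coe] at h
  rw [poisson, ← h, one_pow]

theorem poisson_nonneg {z : ℂ} (hz : z ∈ ball (0 : ℂ) 1) (ζ : Circle) : 0 ≤ poisson z ζ := by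
  rw [poisson_eq]
  have : ‖z‖ < 1 := by simpa using hz
  have : ‖z‖ ^ 2 ≤ 1 := pow_le_one₀ (norm_nonneg _) this.le
  exact div_nonneg (by linarith) (by positivity)

theorem integral_poisson_circleMeasure {z : ℂ} (hz : z ∈ ball (0 : ℂ) 1) :
    ∫ ζ, poisson z ζ ∂circleMeasure = 1 := by
  have h := (DiffContOnCl.circleAverage_re_herglotzRieszKernel_smul' (f := fun _ => (1 : ℂ))
    (c := 0) (R := 1) (w := z) diffContOnCl_const hz)
  simp only [sub_zero, Complex.real_smul, mul_one, Real.circleAverage_def] at h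
  rw [intervalIntegral.integral_ofReal, ← Complex.ofReal_mul, Complex.ofReal_eq_one] at h
  rw [circleMeasure_eq_map, integral_map measurable_circleParam.aemeasurable
    (continuous_poisson hz).aestronglyMeasurable,
    ← intervalIntegral.integral_of_le zero_le_one]
  have hs := intervalIntegral.integral_comp_mul_left (a := 0) (b := 1)
    (fun θ => ((circleMap 0 1 θ + z) / (circleMap 0 1 θ - z)).re) Real.two_pi_pos.ne'
  rw [mul_zero, mul_one, smul_eq_mul, h] at hs
  rw [← hs]
  congr 1 with θ
  simp [poisson, circleParam, circleMap]

theorem norm_singularInner (μ : Measure Circle) [IsFiniteMeasure μ] {z : ℂ}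
    (hz : z ∈ ball (0 : ℂ) 1) :
    ‖singularInner μ z‖ = Real.exp (-∫ ζ, poisson z ζ ∂μ) := by
  rw [singularInner, Complex.norm_exp, Complex.neg_re]
  congr 2
  exact (Complex.reCLM.integral_comp_comm
    (integrable_of_continuous μ (continuous_herglotz hz))).symm

theorem norm_singularInner_le_one (μ : Measure Circle) [IsFiniteMeasure μ] {z : ℂ}
    (hz : z ∈ ball (0 : ℂ) 1) : ‖singularInner μ z‖ ≤ 1 := by
  rw [norm_singularInner μ hz, Real.exp_le_one_iff, neg_nonpos]
  exact integral_nonneg (poisson_nonneg hz)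

theorem singularInner_ne_zero (μ : Measure Circle) (z : ℂ) : singularInner μ z ≠ 0 :=
  Complex.exp_ne_zero _

theorem singularInner_add (μ ν : Measure Circle) [IsFiniteMeasure μ] [IsFiniteMeasure ν] {z : ℂ}
    (hz : z ∈ ball (0 : ℂ) 1) :
    singularInner (μ + ν) z = singularInner μ z * singularInner ν z := by
  rw [singularInner, integral_add_measure (integrable_of_continuous μ (continuous_herglotz hz))
    (integrable_of_continuous ν (continuous_herglotz hz)), neg_add, Complex.exp_add]
  rfl

theorem norm_herglotz_le {z : ℂ} (hz : z ∈ ball (0 : ℂ) 1) (ζ : Circle) :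
    ‖((ζ : ℂ) + z) / ((ζ : ℂ) - z)‖ ≤ 2 / (1 - ‖z‖) := by
  have hz' : ‖z‖ < 1 := by simpa using hz
  rw [norm_div]
  have h1 : ‖(ζ : ℂ) + z‖ ≤ 2 := (norm_add_le _ _).trans (by rw [Circle.norm_coe]; linarith)
  exact div_le_div₀ zero_le_two h1 (by linarith) (one_sub_norm_le z ζ)

theorem differentiableOn_singularInner (μ : Measure Circle) [IsFiniteMeasure μ] :
    DifferentiableOn ℂ (singularInner μ) (ball 0 1) := by
  intro z₀ hz₀
  have hz₀' : ‖z₀‖ < 1 := by simpa using hz₀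
  set ε := (1 - ‖z₀‖) / 2 with hε
  have hε0 : 0 < ε := by rw [hε]; linarith
  have hball : ∀ z ∈ ball z₀ ε, ‖z‖ ≤ 1 - ε := by
    intro z hz
    have h1 : ‖z - z₀‖ < ε := by simpa [dist_eq_norm] using hz
    have h2 : ‖z‖ ≤ ‖z - z₀‖ + ‖z₀‖ := by simpa using norm_add_le (z - z₀) z₀
    linarith
  have hsub : ball z₀ ε ⊆ ball 0 1 := fun z hz => by
    have := hball z hz
    rw [mem_ball_zero_iff]; linarith
  have key := hasDerivAt_integral_of_dominated_loc_of_deriv_le (𝕜 := ℂ) (μ := μ)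
    (F := fun z (ζ : Circle) => ((ζ : ℂ) + z) / ((ζ : ℂ) - z))
    (F' := fun z (ζ : Circle) => 2 * (ζ : ℂ) / ((ζ : ℂ) - z) ^ 2) (x₀ := z₀)
    (bound := fun _ => 2 / ε ^ 2) (s := ball z₀ ε) (ball_mem_nhds z₀ hε0)
    (by
      filter_upwards [ball_mem_nhds z₀ hε0] with z hz
      exact (continuous_herglotz (hsub hz)).aestronglyMeasurable)
    (integrable_of_continuous μ (continuous_herglotz hz₀))
    (by
      refine Continuous.aestronglyMeasurable (Continuous.div (by fun_prop) (by fun_prop) ?_)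
      exact fun ζ => pow_ne_zero 2 (coe_sub_ne_zero hz₀ ζ))
    (by
      refine Eventually.of_forall fun ζ z hz => ?_
      have h1 := one_sub_norm_le z ζ
      have h2 : ε ≤ ‖(ζ : ℂ) - z‖ := by linarith [hball z hz]
      rw [norm_div, norm_mul, norm_pow, Circle.norm_coe]
      simp only [Complex.norm_ofNat, mul_one]
      gcongr)
    (integrable_const _)
    (by
      refine Eventually.of_forall fun ζ z hz => ?_
      have hne := coe_sub_ne_zero (hsub hz) ζ
      have h := ((hasDerivAt_id z).const_add (ζ : ℂ)).div ((hasDerivAt_id z).const_sub (ζ : ℂ)) hne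
      refine h.congr_deriv ?_
      simp only [id]
      ring)
  exact (key.2.neg.cexp).differentiableAt.differentiableWithinAt

theorem norm_singularInner_sub_one_le (μ : Measure Circle) [IsFiniteMeasure μ] {z : ℂ}
    (hz : z ∈ ball (0 : ℂ) 1) (h : 2 / (1 - ‖z‖) * μ.real univ ≤ 1) :
    ‖singularInner μ z - 1‖ ≤ 2 * (2 / (1 - ‖z‖) * μ.real univ) := by
  have h1 : ‖-∫ ζ : Circle, ((ζ : ℂ) + z) / ((ζ : ℂ) - z) ∂μ‖ ≤ 2 / (1 - ‖z‖) * μ.real univ := by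
    rw [norm_neg]
    exact norm_integral_le_of_norm_le_const (Eventually.of_forall (norm_herglotz_le hz))
  exact (Complex.norm_exp_sub_one_le (h1.trans h)).trans (by gcongr)

/-- Both points are at distance at least δ from z, so moving the pole by cδ changes that distance by
a factor at most 1 + c, which the kernel squares. -/
theorem poisson_le_of_norm_sub_le {z : ℂ} {δ : ℝ} (hδ : 0 < δ) (hz : ‖z‖ ≤ 1 - δ) {c : ℝ}
    (hc : 0 ≤ c) {ζ ξ : Circle} (h : ‖(ζ : ℂ) - ξ‖ ≤ c * δ) :
    poisson z ζ ≤ (1 + c) ^ 2 * poisson z ξ := by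
  have hζ : δ ≤ ‖(ζ : ℂ) - z‖ := by linarith [one_sub_norm_le z ζ]
  have hξ : δ ≤ ‖(ξ : ℂ) - z‖ := by linarith [one_sub_norm_le z ξ]
  have h1 : ‖(ξ : ℂ) - z‖ ≤ (1 + c) * ‖(ζ : ℂ) - z‖ := by
    have h2 : ‖(ξ : ℂ) - z‖ ≤ ‖(ζ : ℂ) - ξ‖ + ‖(ζ : ℂ) - z‖ := by
      rw [norm_sub_rev (ζ : ℂ) ξ]
      simpa using norm_add_le ((ξ : ℂ) - ζ) (ζ - z)
    nlinarith
  have hz2 : 0 ≤ 1 - ‖z‖ ^ 2 := by nlinarith [norm_nonneg z]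
  have hp : 0 < ‖(ζ : ℂ) - z‖ := hδ.trans_le hζ
  have hq : 0 < ‖(ξ : ℂ) - z‖ := hδ.trans_le hξ
  rw [poisson_eq, poisson_eq, ← mul_div_assoc, div_le_div_iff₀ (by positivity) (by positivity)]
  have h3 : ‖(ξ : ℂ) - z‖ ^ 2 ≤ (1 + c) ^ 2 * ‖(ζ : ℂ) - z‖ ^ 2 := by
    rw [← mul_pow]; gcongr
  nlinarith

/-- The Harnack constant for arcs comparable to the distance to the boundary. -/
def harnackConst : ℝ := (1 + 2 * Real.pi) ^ 4

theorem harnackConst_pos : 0 < harnackConst := by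
  have := Real.pi_pos
  unfold harnackConst; positivity

/-- At distance at least 1/N from the circle the kernel is nearly constant on each arc. Two uses of
Harnack, one to freeze it on the arc and one to release it, replace ν by T times Lebesgue measure,
whose Poisson integral is T. -/
theorem integral_poisson_le {N : ℕ} (hN : 0 < N) (ν : Measure Circle) [IsFiniteMeasure ν] {T : ℝ}
    (hT : 0 ≤ T) (hν : ∀ j < N, ν.real (arc N j) ≤ T * (N : ℝ)⁻¹) {z : ℂ}
    (hz : ‖z‖ ≤ 1 - (N : ℝ)⁻¹) :
    ∫ ζ, poisson z ζ ∂ν ≤ harnackConst * T := by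
  have hδ : 0 < (N : ℝ)⁻¹ := by positivity
  have hzb : z ∈ ball (0 : ℂ) 1 := by rw [mem_ball_zero_iff]; linarith
  have hpi := Real.two_pi_pos
  have hint := fun ρ : Measure Circle => fun [IsFiniteMeasure ρ] =>
    integrable_of_continuous ρ (continuous_poisson hzb)
  rw [← sum_integral_arc hN ν (hint ν)]
  calc ∑ j ∈ Finset.range N, ∫ x in arc N j, poisson z x ∂ν
      ≤ ∑ j ∈ Finset.range N, harnackConst * T * ∫ x in arc N j, poisson z x ∂circleMeasure := by
        refine Finset.sum_le_sum fun j hj => ?_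
        have hj' := Finset.mem_range.1 hj
        have hne : (arc N j).Nonempty := by
          by_contra h
          rw [not_nonempty_iff_eq_empty] at h
          have := circleMeasure_arc hj'
          rw [h] at this
          simp [eq_comm] at this
        obtain ⟨ξ, hξ⟩ := hne
        have hle : ∀ x ∈ arc N j, ∀ y ∈ arc N j,
            poisson z x ≤ (1 + 2 * Real.pi) ^ 2 * poisson z y := fun x hx y hy =>
          poisson_le_of_norm_sub_le hδ hz hpi.le (by
            simpa [div_eq_mul_inv] using norm_sub_le_of_mem_arc hx hy)
        have h1 : ∫ x in arc N j, poisson z x ∂ν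
            ≤ (1 + 2 * Real.pi) ^ 2 * poisson z ξ * ν.real (arc N j) := by
          have := setIntegral_mono_on (hint ν).integrableOn (integrable_const _).integrableOn
            (measurableSet_arc hj') (fun x hx => hle x hx ξ hξ)
          simpa [mul_comm] using this
        have h2 : poisson z ξ * (N : ℝ)⁻¹
            ≤ (1 + 2 * Real.pi) ^ 2 * ∫ x in arc N j, poisson z x ∂circleMeasure := by
          have := setIntegral_mono_on (μ := circleMeasure) (integrable_const _).integrableOn
            ((hint circleMeasure).const_mul ((1 + 2 * Real.pi) ^ 2)).integrableOn
            (measurableSet_arc hj') (fun x hx => hle ξ hξ x hx)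
          rw [setIntegral_const, circleMeasure_real_arc hj', integral_const_mul] at this
          simpa [mul_comm] using this
        have h0 : 0 ≤ poisson z ξ := poisson_nonneg hzb ξ
        calc ∫ x in arc N j, poisson z x ∂ν
            ≤ (1 + 2 * Real.pi) ^ 2 * poisson z ξ * (T * (N : ℝ)⁻¹) :=
              h1.trans (by gcongr; exact hν j hj')
          _ = (1 + 2 * Real.pi) ^ 2 * T * (poisson z ξ * (N : ℝ)⁻¹) := by ring
          _ ≤ (1 + 2 * Real.pi) ^ 2 * T * ((1 + 2 * Real.pi) ^ 2 *
                ∫ x in arc N j, poisson z x ∂circleMeasure) := by gcongr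
          _ = _ := by rw [harnackConst]; ring
    _ = harnackConst * T := by
        rw [← Finset.mul_sum, sum_integral_arc hN _ (hint _), integral_poisson_circleMeasure hzb,
          mul_one]

theorem norm_singularInner_inv_le {N : ℕ} (hN : 0 < N) (ν : Measure Circle) [IsFiniteMeasure ν]
    {T : ℝ} (hT : 0 ≤ T) (hν : ∀ j < N, ν.real (arc N j) ≤ T * (N : ℝ)⁻¹) {z : ℂ}
    (hz : ‖z‖ ≤ 1 - (N : ℝ)⁻¹) :
    ‖(singularInner ν z)⁻¹‖ ≤ Real.exp (harnackConst * T) := by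
  have hδ : 0 < (N : ℝ)⁻¹ := by positivity
  have hzb : z ∈ ball (0 : ℂ) 1 := by rw [mem_ball_zero_iff]; linarith
  rw [norm_inv, norm_singularInner ν hzb, ← Real.exp_neg, neg_neg, Real.exp_le_exp]
  exact integral_poisson_le hN ν hT hν hz

/-! ### Growth spaces -/

variable {W : ℝ → ℝ}

theorem growthNorm_le {f : ℂ → ℂ} {ε : ℝ}
    (h : ∀ z ∈ ball (0 : ℂ) 1, W (1 - ‖z‖) * ‖f z‖ ≤ ε) : growthNorm W f ≤ ENNReal.ofReal ε :=
  iSup₂_le fun z hz => ENNReal.ofReal_le_ofReal (h z hz)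

theorem one_sub_norm_mem {z : ℂ} (hz : z ∈ ball (0 : ℂ) 1) : 1 - ‖z‖ ∈ Ioc (0 : ℝ) 1 := by
  rw [mem_ball_zero_iff] at hz
  exact ⟨by linarith, by linarith [norm_nonneg z]⟩

theorem IsGoodWeight.pos (hW : IsGoodWeight W) {z : ℂ} (hz : z ∈ ball (0 : ℂ) 1) :
    0 < W (1 - ‖z‖) := (hW.mem_Ioc _ (one_sub_norm_mem hz)).1

theorem IsGoodWeight.le_one (hW : IsGoodWeight W) {z : ℂ} (hz : z ∈ ball (0 : ℂ) 1) :
    W (1 - ‖z‖) ≤ 1 := (hW.mem_Ioc _ (one_sub_norm_mem hz)).2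

theorem IsGoodWeight.memGrowth_of_bounded (hW : IsGoodWeight W) {f : ℂ → ℂ}
    (hf : DifferentiableOn ℂ f (ball 0 1)) {B : ℝ} (hB : ∀ z ∈ ball (0 : ℂ) 1, ‖f z‖ ≤ B) :
    MemGrowth W f := by
  refine ⟨hf, ?_⟩
  have h1 : Tendsto (fun z : ℂ => 1 - ‖z‖) (comap (fun z : ℂ => ‖z‖) (𝓝[<] 1)) (𝓝[>] 0) := by
    have h2 : Tendsto (fun t : ℝ => 1 - t) (𝓝[<] 1) (𝓝[>] 0) := by
      refine tendsto_nhdsWithin_iff.2 ⟨?_, ?_⟩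
      · have : Continuous fun t : ℝ => 1 - t := by fun_prop
        simpa using (this.tendsto 1).mono_left nhdsWithin_le_nhds
      · filter_upwards [self_mem_nhdsWithin] with t ht
        simpa using ht
    exact h2.comp tendsto_comap
  have h3 : Tendsto (fun z : ℂ => W (1 - ‖z‖) * B) (comap (fun z : ℂ => ‖z‖) (𝓝[<] 1)) (𝓝 0) := by
    simpa using (hW.tendsto_zero.comp h1).mul_const B
  have h4 : ∀ᶠ z : ℂ in comap (fun z : ℂ => ‖z‖) (𝓝[<] 1), z ∈ ball (0 : ℂ) 1 := by
    have : ∀ᶠ t : ℝ in 𝓝[<] 1, t < 1 := self_mem_nhdsWithin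
    filter_upwards [tendsto_comap.eventually this] with z hz
    simpa using hz
  refine tendsto_of_tendsto_of_tendsto_of_le_of_le' tendsto_const_nhds h3 ?_ ?_
  · filter_upwards [h4] with z hz
    exact mul_nonneg (hW.pos hz).le (norm_nonneg _)
  · filter_upwards [h4] with z hz
    exact mul_le_mul_of_nonneg_left (hB z hz) (hW.pos hz).le

theorem MemGrowth.exists_forall_le {g : ℂ → ℂ} (hg : MemGrowth W g) {ε : ℝ} (hε : 0 < ε) :
    ∃ ρ < 1, 0 < ρ ∧ ∀ z ∈ ball (0 : ℂ) 1, ρ < ‖z‖ → W (1 - ‖z‖) * ‖g z‖ ≤ ε := by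
  have h := hg.tendsto_zero.eventually (gt_mem_nhds hε)
  rw [eventually_comap] at h
  obtain ⟨l, hl, hsub⟩ := (mem_nhdsLT_iff_exists_mem_Ico_Ioo_subset (a := (1 : ℝ)) zero_lt_one).1 h
  refine ⟨(l + 1) / 2, by linarith [hl.2], by linarith [hl.1], fun z hz hlz => ?_⟩
  have hz1 : ‖z‖ < 1 := by simpa using hz
  exact (hsub (show ‖z‖ ∈ Ioo l 1 from ⟨by linarith [hl.2], hz1⟩) z rfl).le

theorem smul_mem_ball {s : ℝ} (hs : s ∈ Ioo (0 : ℝ) 1) {z : ℂ} (hz : z ∈ ball (0 : ℂ) 1) :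
    (s : ℂ) * z ∈ ball (0 : ℂ) 1 := by
  rw [mem_ball_zero_iff] at hz ⊢
  rw [norm_mul, Complex.norm_real, Real.norm_of_nonneg hs.1.le]
  nlinarith [hs.1, hs.2, norm_nonneg z]

/-- Dilations converge in the growth space. -/
theorem exists_dilation (hW : IsGoodWeight W) {g : ℂ → ℂ} (hg : MemGrowth W g) {ε : ℝ}
    (hε : 0 < ε) :
    ∃ s ∈ Ioo (0 : ℝ) 1, ∀ z ∈ ball (0 : ℂ) 1, W (1 - ‖z‖) * ‖g (s * z) - g z‖ ≤ ε := by
  obtain ⟨ρ, hρ1, hρ0, hρ⟩ := hg.exists_forall_le (half_pos hε)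
  set σ := (1 + ρ) / 2 with hσ
  have hσ1 : σ < 1 := by rw [hσ]; linarith
  have hρσ : ρ < σ := by rw [hσ]; linarith
  have huc : UniformContinuousOn g (closedBall 0 σ) :=
    (isCompact_closedBall 0 σ).uniformContinuousOn_of_continuous
      (hg.differentiableOn.continuousOn.mono (closedBall_subset_ball hσ1))
  obtain ⟨η, hη, hucη⟩ := Metric.uniformContinuousOn_iff.1 huc ε hε
  -- s > ρ/σ keeps sz outside radius ρ when |z| > σ, where both terms are small separately; s > 1 -
  -- η serves uniform continuity inside radius σ.
  obtain ⟨s, hs1, hs2⟩ : ∃ s, max (max (ρ / σ) (1 - η)) 0 < s ∧ s < 1 := by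
    refine exists_between (max_lt (max_lt ?_ (by linarith)) one_pos)
    rw [div_lt_one (by linarith)]; exact hρσ
  have hs0 : 0 < s := (le_max_right _ _).trans_lt hs1
  have hsρ : ρ / σ < s := (le_max_left _ _).trans_lt ((le_max_left _ _).trans_lt hs1)
  have hsη : 1 - η < s := (le_max_right _ _).trans_lt ((le_max_left _ _).trans_lt hs1)
  rw [div_lt_iff₀ (by linarith)] at hsρ
  refine ⟨s, ⟨hs0, hs2⟩, fun z hz => ?_⟩
  have hz1 : ‖z‖ < 1 := by simpa using hz
  have hnorm : ‖(s : ℂ) * z‖ = s * ‖z‖ := by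
    rw [norm_mul, Complex.norm_real, Real.norm_of_nonneg hs0.le]
  have hsz := smul_mem_ball ⟨hs0, hs2⟩ hz
  have hle : ‖(s : ℂ) * z‖ ≤ ‖z‖ := by rw [hnorm]; nlinarith [norm_nonneg z]
  rcases le_or_gt ‖z‖ σ with h | h
  · have hd : dist ((s : ℂ) * z) z < η := by
      rw [dist_eq_norm, show (s : ℂ) * z - z = ((s - 1 : ℝ) : ℂ) * z by push_cast; ring, norm_mul,
        Complex.norm_real, Real.norm_of_nonpos (by linarith)]
      nlinarith [norm_nonneg z]
    have := hucη _ (by simpa using hle.trans h) z (by simpa using h) hd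
    rw [dist_eq_norm] at this
    calc W (1 - ‖z‖) * ‖g (s * z) - g z‖ ≤ 1 * ε := by
          gcongr
          exact hW.le_one hz
      _ = ε := one_mul ε
  · have h1 := hρ z hz (hρσ.trans h)
    have h2 := hρ _ hsz (by rw [hnorm]; nlinarith)
    have h3 : W (1 - ‖z‖) ≤ W (1 - ‖(s : ℂ) * z‖) :=
      hW.monotoneOn (one_sub_norm_mem hz) (one_sub_norm_mem hsz) (by linarith)
    calc W (1 - ‖z‖) * ‖g (s * z) - g z‖
        ≤ W (1 - ‖z‖) * (‖g (s * z)‖ + ‖g z‖) := by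
          have := (hW.pos hz).le
          gcongr
          exact norm_sub_le _ _
      _ ≤ W (1 - ‖(s : ℂ) * z‖) * ‖g (s * z)‖ + W (1 - ‖z‖) * ‖g z‖ := by
          rw [mul_add]
          gcongr
      _ ≤ ε := by linarith

/-- The dilated function is holomorphic on a disc of radius r with 1 < r < 1/s, so its Taylor sums
converge uniformly on the unit disc. -/
theorem exists_polynomial_dilation {φ : ℂ → ℂ} (hφ : DifferentiableOn ℂ φ (ball 0 1)) {s : ℝ}
    (hs : s ∈ Ioo (0 : ℝ) 1) {ε : ℝ} (hε : 0 < ε) :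
    ∃ p : Polynomial ℂ, ∀ z ∈ ball (0 : ℂ) 1, ‖p.eval z - φ (s * z)‖ ≤ ε := by
  have hs0 := hs.1
  obtain ⟨r, hr1, hr2⟩ := exists_between ((one_lt_inv₀ hs.1).2 hs.2)
  have hr0 : 0 < r := one_pos.trans hr1
  lift r to NNReal using hr0.le
  have hmaps : MapsTo (fun z : ℂ => (s : ℂ) * z) (closedBall 0 r) (ball 0 1) := by
    intro z hz
    rw [mem_closedBall_zero_iff] at hz
    rw [mem_ball_zero_iff, norm_mul, Complex.norm_real, Real.norm_of_nonneg hs0.le]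
    calc s * ‖z‖ ≤ s * r := by gcongr
      _ < s * s⁻¹ := by gcongr
      _ = 1 := mul_inv_cancel₀ hs0.ne'
  have hd : DifferentiableOn ℂ (fun z => φ (s * z)) (closedBall 0 r) :=
    hφ.comp (by fun_prop) hmaps
  have hp := hd.hasFPowerSeriesOnBall (by exact_mod_cast hr0)
  have hu := hp.tendstoUniformlyOn (r' := 1) (by exact_mod_cast hr1)
  obtain ⟨n, hn⟩ := ((Metric.tendstoUniformlyOn_iff.1 hu) ε hε).exists
  refine ⟨∑ k ∈ Finset.range n,
    Polynomial.monomial k ((cauchyPowerSeries (fun z => φ (s * z)) 0 r).coeff k), fun z hz => ?_⟩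
  have h := hn z (by simpa using hz)
  rw [dist_comm, dist_eq_norm, zero_add, FormalMultilinearSeries.partialSum] at h
  rw [Polynomial.eval_finsetSum]
  refine le_of_eq_of_le ?_ h.le
  congr 2
  refine Finset.sum_congr rfl fun k _ => ?_
  rw [FormalMultilinearSeries.apply_eq_pow_smul_coeff, Polynomial.eval_monomial, smul_eq_mul,
    mul_comm]

theorem polynomial_mul_mem_span (p : Polynomial ℂ) (f : ℂ → ℂ) :
    (fun z => p.eval z * f z) ∈
      Submodule.span ℂ (range fun (n : ℕ) (z : ℂ) => z ^ n * f z) := by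
  have e : (fun z => p.eval z * f z)
      = ∑ k ∈ Finset.range (p.natDegree + 1), p.coeff k • fun z : ℂ => z ^ k * f z := by
    ext z
    rw [Polynomial.eval_eq_sum_range, Finset.sum_mul, Finset.sum_apply]
    exact Finset.sum_congr rfl fun k _ => by simp [mul_assoc]
  rw [e]
  exact Submodule.sum_mem _ fun k _ =>
    Submodule.smul_mem _ _ (Submodule.subset_span (mem_range_self k))

/-- A bounded function is cyclic as soon as the constant `1` can be approximated by its bounded
multiples. -/
theorem IsGoodWeight.isCyclicVector_of_approx_one (hW : IsGoodWeight W) {Θ : ℂ → ℂ}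
    (hΘ : DifferentiableOn ℂ Θ (ball 0 1)) (hΘ1 : ∀ z ∈ ball (0 : ℂ) 1, ‖Θ z‖ ≤ 1)
    (h : ∀ ε > 0, ∃ (F : ℂ → ℂ) (B : ℝ), DifferentiableOn ℂ F (ball 0 1) ∧
      (∀ z ∈ ball (0 : ℂ) 1, ‖F z‖ ≤ B) ∧
      ∀ z ∈ ball (0 : ℂ) 1, W (1 - ‖z‖) * ‖Θ z * F z - 1‖ ≤ ε) :
    IsCyclicVector W Θ := by
  refine ⟨hW.memGrowth_of_bounded hΘ hΘ1, fun g hg ε hε => ?_⟩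
  obtain ⟨δ, hδ0, hδε⟩ : ∃ δ : ℝ, 0 < δ ∧ ENNReal.ofReal (5 * δ) < ε := by
    obtain ⟨a, ha0, ha⟩ := ENNReal.lt_iff_exists_nnreal_btwn.1 hε
    refine ⟨a / 5, by have : 0 < a := by exact_mod_cast ha0
                      positivity, ?_⟩
    rwa [mul_div_cancel₀ _ (by norm_num), ENNReal.ofReal_coe_nnreal]
  obtain ⟨s, hs, hgs⟩ := exists_dilation hW hg hδ0
  obtain ⟨q, hq⟩ := exists_polynomial_dilation hg.differentiableOn hs hδ0
  obtain ⟨C, hC0, hC⟩ : ∃ C > 0, ∀ z ∈ ball (0 : ℂ) 1, ‖q.eval z‖ ≤ C := by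
    obtain ⟨C, hC⟩ := (isCompact_closedBall (0 : ℂ) 1).exists_bound_of_continuousOn
      (f := fun z => q.eval z) q.continuous.continuousOn
    exact ⟨max C 1, by positivity, fun z hz =>
      (hC z (ball_subset_closedBall hz)).trans (le_max_left _ _)⟩
  obtain ⟨F, B, hF, hFB, hΘF⟩ := h (δ / C) (by positivity)
  have hφ : DifferentiableOn ℂ (fun z => F z * q.eval z) (ball 0 1) :=
    hF.mul q.differentiable.differentiableOn
  have hφm : MemGrowth W fun z => F z * q.eval z :=
    hW.memGrowth_of_bounded hφ (B := B * C) fun z hz => by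
      rw [norm_mul]
      exact mul_le_mul (hFB z hz) (hC z hz) (norm_nonneg _) ((norm_nonneg _).trans (hFB z hz))
  obtain ⟨t, ht, hφt⟩ := exists_dilation hW hφm hδ0
  obtain ⟨p, hp⟩ := exists_polynomial_dilation hφ ht hδ0
  refine ⟨_, polynomial_mul_mem_span p Θ, lt_of_le_of_lt (growthNorm_le fun z hz => ?_) hδε⟩
  have hw := hW.pos hz
  have hw1 := hW.le_one hz
  set w := W (1 - ‖z‖)
  -- Five errors, each at most δ in norm: p for the dilated product Fq, the dilation of Fq, ΘF for
  -- 1, q for the dilated g, and the dilation of g.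
  have e : p.eval z * Θ z - g z
      = Θ z * (p.eval z - F (t * z) * q.eval (t * z))
        + Θ z * (F (t * z) * q.eval (t * z) - F z * q.eval z)
        + q.eval z * (Θ z * F z - 1) + (q.eval z - g (s * z)) + (g (s * z) - g z) := by ring
  have h1 : w * ‖Θ z * (p.eval z - F (t * z) * q.eval (t * z))‖ ≤ δ := by
    rw [norm_mul]
    calc w * (‖Θ z‖ * ‖p.eval z - F (t * z) * q.eval (t * z)‖) ≤ 1 * (1 * δ) := by
          gcongr
          · exact hΘ1 z hz
          · exact hp z hz
      _ = δ := by ring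
  have h2 : w * ‖Θ z * (F (t * z) * q.eval (t * z) - F z * q.eval z)‖ ≤ δ := by
    rw [norm_mul, mul_left_comm]
    exact (mul_le_of_le_one_left (by positivity) (hΘ1 z hz)).trans (hφt z hz)
  have h3 : w * ‖q.eval z * (Θ z * F z - 1)‖ ≤ δ := by
    rw [norm_mul, mul_left_comm]
    calc ‖q.eval z‖ * (w * ‖Θ z * F z - 1‖) ≤ C * (δ / C) := by
          gcongr
          · exact hC z hz
          · exact hΘF z hz
      _ = δ := by field_simp
  have h4 : w * ‖q.eval z - g (s * z)‖ ≤ δ := by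
    calc w * ‖q.eval z - g (s * z)‖ ≤ 1 * δ := by
          gcongr
          exact hq z hz
      _ = δ := one_mul δ
  have h5 : w * ‖g (s * z) - g z‖ ≤ δ := hgs z hz
  have hle : ‖p.eval z * Θ z - g z‖ ≤ ‖Θ z * (p.eval z - F (t * z) * q.eval (t * z))‖
      + ‖Θ z * (F (t * z) * q.eval (t * z) - F z * q.eval z)‖
      + ‖q.eval z * (Θ z * F z - 1)‖ + ‖q.eval z - g (s * z)‖ + ‖g (s * z) - g z‖ := by
    rw [e]
    exact (norm_add_le _ _).trans (add_le_add_left ((norm_add_le _ _).trans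
      (add_le_add_left ((norm_add_le _ _).trans (add_le_add_left (norm_add_le _ _) _)) _)) _)
  calc w * ‖p.eval z * Θ z - g z‖ ≤ w * _ := mul_le_mul_of_nonneg_left hle hw.le
    _ ≤ 5 * δ := by simp only [mul_add]; linarith

/-! ### The logarithm of a weight -/

/-- The function `log (1 / W)`. -/
def logInv (W : ℝ → ℝ) (t : ℝ) : ℝ := Real.log (1 / W t)

theorem IsGoodWeight.eq_exp (hW : IsGoodWeight W) {t : ℝ} (ht : t ∈ Ioc (0 : ℝ) 1) :
    W t = Real.exp (-logInv W t) := by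
  rw [logInv, one_div, Real.log_inv, neg_neg, Real.exp_log (hW.mem_Ioc t ht).1]

theorem IsGoodWeight.logInv_nonneg (hW : IsGoodWeight W) {t : ℝ} (ht : t ∈ Ioc (0 : ℝ) 1) :
    0 ≤ logInv W t := by
  obtain ⟨h0, h1⟩ := hW.mem_Ioc t ht
  exact Real.log_nonneg ((one_le_div h0).2 h1)

theorem IsGoodWeight.logInv_antitone (hW : IsGoodWeight W) {s t : ℝ} (hs : 0 < s) (hst : s ≤ t)
    (ht : t ≤ 1) : logInv W t ≤ logInv W s := by
  have hs' : s ∈ Ioc (0 : ℝ) 1 := ⟨hs, hst.trans ht⟩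
  have ht' : t ∈ Ioc (0 : ℝ) 1 := ⟨hs.trans_le hst, ht⟩
  have h := hW.monotoneOn hs' ht' hst
  have h0 := (hW.mem_Ioc s hs').1
  have h1 := (hW.mem_Ioc t ht').1
  exact Real.log_le_log (by positivity) (by gcongr)

theorem IsGoodWeight.tendsto_logInv (hW : IsGoodWeight W) :
    Tendsto (logInv W) (𝓝[>] 0) atTop := by
  have h1 : ∀ᶠ t in 𝓝[>] (0 : ℝ), t ∈ Ioc (0 : ℝ) 1 := Ioc_mem_nhdsGT one_pos
  have h2 : Tendsto W (𝓝[>] 0) (𝓝[>] 0) :=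
    tendsto_nhdsWithin_iff.2 ⟨hW.tendsto_zero, h1.mono fun t ht => (hW.mem_Ioc t ht).1⟩
  have h3 := Real.tendsto_log_atTop.comp (tendsto_inv_nhdsGT_zero.comp h2)
  refine h3.congr fun t => ?_
  simp [logInv]

/-- `log (1 / W)` is doubling with constant `C` on `(0, τ]`. -/
structure IsDoublingOn (W : ℝ → ℝ) (C τ : ℝ) : Prop where
  one_lt : 1 < C
  pos : 0 < τ
  le_one : τ ≤ 1
  le : ∀ t ∈ Ioc 0 τ, logInv W (t / 2) ≤ C * logInv W t

theorem IsGoodWeight.exists_isDoublingOn (hW : IsGoodWeight W) : ∃ C τ, IsDoublingOn W C τ := by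
  obtain ⟨C, hC, h⟩ := hW.doubling
  obtain ⟨u, hu, hsub⟩ := mem_nhdsGT_iff_exists_Ioc_subset.1 h
  exact ⟨C, min u 1, hC, lt_min hu one_pos, min_le_right _ _, fun t ht =>
    hsub ⟨ht.1, ht.2.trans (min_le_left _ _)⟩⟩

theorem IsDoublingOn.le_pow {C τ : ℝ} (h : IsDoublingOn W C τ) (k : ℕ) {t : ℝ}
    (ht : t ∈ Ioc 0 τ) : logInv W (t / 2 ^ k) ≤ C ^ k * logInv W t := by
  induction k with
  | zero => simp
  | succ k ih =>
    have h1 : t / 2 ^ k ∈ Ioc 0 τ :=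
      ⟨by have := ht.1; positivity, (div_le_self ht.1.le (one_le_pow₀ one_le_two)).trans ht.2⟩
    have h2 := h.le _ h1
    rw [div_div, ← pow_succ] at h2
    refine h2.trans ?_
    rw [pow_succ', mul_assoc]
    have := h.one_lt
    gcongr

/-- The exponent gained by the powers of `z` in the growth norm. -/
def gain (C : ℝ) : ℝ := (C ^ 6)⁻¹

/-- Within 64δ of the circle the weight does the work: six doublings give L(64δ) ≥ C⁻⁶ L(δ). Further
inside, the power does: |z|^n ≤ exp(-64nδ). -/
theorem IsGoodWeight.mul_pow_le (hW : IsGoodWeight W) {C τ : ℝ} (hC : IsDoublingOn W C τ)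
    {δ : ℝ} (hδ : 0 < δ) (hδτ : 64 * δ ≤ τ) {n : ℕ}
    (hn : gain C * logInv W δ ≤ n * (64 * δ)) {z : ℂ} (hz : z ∈ ball (0 : ℂ) 1) :
    W (1 - ‖z‖) * ‖z‖ ^ n ≤ Real.exp (-(gain C * logInv W δ)) := by
  have hmem := one_sub_norm_mem hz
  have hz1 : ‖z‖ ≤ 1 := by linarith [hmem.1]
  have hC0 : 0 < C := one_pos.trans hC.one_lt
  rcases le_or_gt (1 - ‖z‖) (64 * δ) with h | h
  · have h64 : 64 * δ ∈ Ioc (0 : ℝ) 1 := ⟨by positivity, hδτ.trans hC.le_one⟩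
    have h1 := hC.le_pow 6 (t := 64 * δ) ⟨h64.1, hδτ⟩
    rw [show 64 * δ / 2 ^ 6 = δ by ring] at h1
    calc W (1 - ‖z‖) * ‖z‖ ^ n ≤ W (64 * δ) * 1 := by
          have := (hW.mem_Ioc _ h64).1
          gcongr
          · exact hW.monotoneOn hmem h64 h
          · exact pow_le_one₀ (norm_nonneg _) hz1
      _ = Real.exp (-logInv W (64 * δ)) := by rw [mul_one, hW.eq_exp h64]
      _ ≤ _ := by
          rw [Real.exp_le_exp, neg_le_neg_iff, gain, inv_mul_le_iff₀ (by positivity)]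
          exact h1
  · calc W (1 - ‖z‖) * ‖z‖ ^ n ≤ 1 * Real.exp (-(1 - ‖z‖)) ^ n := by
          gcongr
          · exact hW.le_one hz
          · have := Real.one_sub_le_exp_neg (1 - ‖z‖)
            linarith
      _ = Real.exp (-(n * (1 - ‖z‖))) := by rw [one_mul, ← Real.exp_nat_mul]; ring_nf
      _ ≤ _ := by
          rw [Real.exp_le_exp, neg_le_neg_iff]
          refine hn.trans ?_
          gcongr

/-- The constant in the bounds of the approximate inverses. -/
def approxConst : ℝ := 3 / 2 * Real.exp 4

theorem one_le_approxConst : 1 ≤ approxConst := by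
  unfold approxConst
  linarith [Real.add_one_le_exp 4]

/-- A measure that is uniformly small on the arcs of length `1 / N` has an inner function which is
boundedly invertible up to a small error in the growth norm. -/
theorem IsGoodWeight.exists_approx_inverse (hW : IsGoodWeight W) {C τ : ℝ}
    (hC : IsDoublingOn W C τ) {N : ℕ} (hN : 0 < N) (hNτ : 64 * (N : ℝ)⁻¹ ≤ τ)
    (hL : 0 < logInv W (N : ℝ)⁻¹) (ν : Measure Circle) [IsFiniteMeasure ν]
    (hν : ∀ j < N, ν.real (arc N j)
      ≤ gain C / (8 * harnackConst) * logInv W (N : ℝ)⁻¹ * (N : ℝ)⁻¹) :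
    ∃ f : ℂ → ℂ, Differentiable ℂ f ∧
      (∀ z ∈ ball (0 : ℂ) 1,
        ‖f z‖ ≤ approxConst * Real.exp (gain C / 4 * logInv W (N : ℝ)⁻¹)) ∧
      ∀ z ∈ ball (0 : ℂ) 1, W (1 - ‖z‖) * ‖singularInner ν z * f z - 1‖
        ≤ 2 * approxConst * Real.exp (-(3 * gain C / 4 * logInv W (N : ℝ)⁻¹)) := by
  have hC0 : 0 < C := one_pos.trans hC.one_lt
  have hb : 0 < gain C := by unfold gain; positivity
  set b := gain C
  set L := logInv W (N : ℝ)⁻¹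
  set δ := (N : ℝ)⁻¹ with hδ
  have hδ0 : 0 < δ := by positivity
  have hδ1 : δ ≤ 1 / 64 := by have := hNτ.trans hC.le_one; linarith
  -- Least n for which |z|^n yields the full gain exp(-bL). The price (1-δ)^(-4n) ≤ exp(8nδ) is then
  -- only exp(bL/8 + 8δ); the Harnack bound adds another exp(bL/8), and `approxConst` absorbs the
  -- rounding term 8δ.
  set n := ⌈b * L / (64 * δ)⌉₊ with hn
  have hn0 : 0 < n := Nat.ceil_pos.2 (by positivity)
  have hn1 : b * L ≤ n * (64 * δ) := (div_le_iff₀ (by positivity)).1 (Nat.le_ceil _)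
  have hn2 : n * δ ≤ b * L / 64 + δ := by
    have h1 : (n : ℝ) < b * L / (64 * δ) + 1 := Nat.ceil_lt_add_one (by positivity)
    calc n * δ ≤ (b * L / (64 * δ) + 1) * δ := by gcongr
      _ = b * L / 64 + δ := by field_simp
  have hH := harnackConst_pos
  obtain ⟨f, hfd, hfB, hfz⟩ := exists_bounded_approx_inverse (Θ := singularInner ν)
    (differentiableOn_singularInner ν) (fun z hz => norm_singularInner_le_one ν hz)
    (fun z _ => singularInner_ne_zero ν z) (r := 1 - δ) (by linarith) (by linarith)
    (M := Real.exp (harnackConst * (b / (8 * harnackConst) * L)))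
    (fun z hz => norm_singularInner_inv_le hN ν (by positivity) hν
      (by simpa using (mem_sphere_zero_iff_norm.1 hz).le)) hn0
  have hpow : 3 / 2 * (1 - δ)⁻¹ ^ (4 * n) * Real.exp (harnackConst * (b / (8 * harnackConst) * L))
      ≤ approxConst * Real.exp (b / 4 * L) := by
    have h1 : (1 - δ)⁻¹ ≤ Real.exp (2 * δ) := by
      rw [inv_le_iff_one_le_mul₀ (by linarith)]
      calc 1 ≤ (2 * δ + 1) * (1 - δ) := by nlinarith
        _ ≤ Real.exp (2 * δ) * (1 - δ) := by
            have := Real.add_one_le_exp (2 * δ)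
            gcongr
            linarith
    calc 3 / 2 * (1 - δ)⁻¹ ^ (4 * n) * Real.exp (harnackConst * (b / (8 * harnackConst) * L))
        ≤ 3 / 2 * Real.exp (2 * δ) ^ (4 * n)
          * Real.exp (harnackConst * (b / (8 * harnackConst) * L)) := by
          have : 0 ≤ (1 - δ)⁻¹ := inv_nonneg.2 (by linarith)
          gcongr
      _ = 3 / 2 * Real.exp (8 * (n * δ) + b / 8 * L) := by
          rw [← Real.exp_nat_mul, mul_assoc, ← Real.exp_add]
          congr 2
          push_cast
          field_simp
          ring
      _ ≤ 3 / 2 * Real.exp (4 + b / 4 * L) := by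
          refine mul_le_mul_of_nonneg_left (Real.exp_le_exp.2 ?_) (by norm_num)
          linarith
      _ = approxConst * Real.exp (b / 4 * L) := by rw [Real.exp_add, approxConst, mul_assoc]
  refine ⟨f, hfd, fun z hz => (hfB z hz).trans hpow, fun z hz => ?_⟩
  have hw := (hW.pos hz).le
  have hB1 : 1 ≤ approxConst * Real.exp (b / 4 * L) :=
    one_le_mul_of_one_le_of_one_le one_le_approxConst (Real.one_le_exp (by positivity))
  calc W (1 - ‖z‖) * ‖singularInner ν z * f z - 1‖
      ≤ W (1 - ‖z‖) * ((2 * (approxConst * Real.exp (b / 4 * L))) * ‖z‖ ^ n) := by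
        gcongr
        refine (hfz z hz).trans ?_
        gcongr
        linarith
    _ = 2 * approxConst * Real.exp (b / 4 * L) * (W (1 - ‖z‖) * ‖z‖ ^ n) := by ring
    _ ≤ 2 * approxConst * Real.exp (b / 4 * L) * Real.exp (-(b * L)) := by
        have := one_le_approxConst
        gcongr
        exact hW.mul_pow_le hC hδ0 hNτ hn1 hz
    _ = _ := by
        rw [mul_assoc, ← Real.exp_add]
        congr 2
        ring

/-- Dyadic scales along which `log (1 / W)` grows at a controlled geometric rate. -/
theorem IsGoodWeight.exists_scales (hW : IsGoodWeight W) {C τ : ℝ} (hC : IsDoublingOn W C τ)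
    {n₀ : ℕ} (hn₀ : ((2 : ℝ) ^ n₀)⁻¹ ≤ τ) (hL : 0 < logInv W ((2 : ℝ) ^ n₀)⁻¹) :
    ∃ n : ℕ → ℕ, n 0 = n₀ ∧ Monotone n ∧ ∀ k,
      2 * logInv W ((2 : ℝ) ^ n k)⁻¹ ≤ logInv W ((2 : ℝ) ^ n (k + 1))⁻¹ ∧
      logInv W ((2 : ℝ) ^ n (k + 1))⁻¹ ≤ 2 * C * logInv W ((2 : ℝ) ^ n k)⁻¹ := by
  set ℓ : ℕ → ℝ := fun m => logInv W ((2 : ℝ) ^ m)⁻¹ with hℓ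
  have hmono : Monotone ℓ := by
    intro a c hac
    refine hW.logInv_antitone (by positivity) ?_ (inv_le_one_of_one_le₀ (one_le_pow₀ one_le_two))
    gcongr
    exact one_le_two
  have htend : Tendsto ℓ atTop atTop := by
    refine hW.tendsto_logInv.comp (tendsto_nhdsWithin_iff.2 ⟨?_, ?_⟩)
    · exact (tendsto_pow_atTop_atTop_of_one_lt one_lt_two).inv_tendsto_atTop
    · exact Eventually.of_forall fun m => by simp
  have hC0 : 0 < C := one_pos.trans hC.one_lt
  -- Take the first dyadic scale at which ℓ has doubled. Its predecessor has not doubled, and one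
  -- dyadic step multiplies ℓ by at most C, hence the upper factor 2C.
  have hstep : ∀ m : ℕ, ∃ m', n₀ ≤ m → m ≤ m' ∧ 2 * ℓ m ≤ ℓ m' ∧ ℓ m' ≤ 2 * C * ℓ m := by
    intro m
    classical
    by_cases hm : n₀ ≤ m
    swap
    -- Junk value: scales coarser than n₀ are never visited.
    · exact ⟨0, fun h => absurd h hm⟩
    have hpos : 0 < ℓ m := hL.trans_le (hmono hm)
    have hex : ∃ m', 2 * ℓ m ≤ ℓ m' := (htend.eventually_ge_atTop _).exists
    refine ⟨Nat.find hex, fun _ => ?_⟩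
    have h1 := Nat.find_spec hex
    have hlt : m < Nat.find hex := by
      by_contra hle
      have := hmono (not_lt.1 hle)
      linarith
    refine ⟨hlt.le, h1, ?_⟩
    obtain ⟨q, hq⟩ := Nat.exists_eq_add_of_lt hlt
    have h2 := Nat.find_min hex (m := m + q) (by omega)
    rw [hq]
    have h3 := hC.le ((2 : ℝ) ^ (m + q))⁻¹ ⟨by positivity, by
      refine le_trans ?_ hn₀
      gcongr
      · exact one_le_two
      · omega⟩
    rw [div_eq_mul_inv, ← mul_inv, ← pow_succ] at h3
    calc ℓ (m + q + 1) ≤ C * ℓ (m + q) := h3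
      _ ≤ C * (2 * ℓ m) := by gcongr; exact (not_le.1 h2).le
      _ = 2 * C * ℓ m := by ring
  choose next hnext using hstep
  set n : ℕ → ℕ := fun k => Nat.rec n₀ (fun _ m => next m) k with hndef
  have hsucc : ∀ k, n (k + 1) = next (n k) := fun k => rfl
  have hge : ∀ k, n₀ ≤ n k := by
    intro k
    induction k with
    | zero => exact le_rfl
    | succ k ih => rw [hsucc]; exact ih.trans (hnext _ ih).1
  refine ⟨n, rfl, monotone_nat_of_le_succ fun k => ?_, fun k => ?_⟩
  · rw [hsucc]; exact (hnext _ (hge k)).1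
  · rw [hsucc]; exact (hnext _ (hge k)).2

/-! ### Decomposition of measures -/

/-- The fraction of the mass of the `j`-th arc that is kept when masses are truncated at `t`. -/
def keepRatio (ρ : Measure Circle) (N : ℕ) (t : ℝ≥0∞) (j : ℕ) : ℝ≥0∞ := min 1 (t / ρ (arc N j))

/-- The part of `ρ` obtained by truncating the masses of the arcs at `t`. -/
def lightPart (ρ : Measure Circle) (N : ℕ) (t : ℝ≥0∞) : Measure Circle :=
  ∑ j ∈ Finset.range N, keepRatio ρ N t j • ρ.restrict (arc N j)

/-- The part of `ρ` left over after truncation. -/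
def heavyPart (ρ : Measure Circle) (N : ℕ) (t : ℝ≥0∞) : Measure Circle :=
  ∑ j ∈ Finset.range N, (1 - keepRatio ρ N t j) • ρ.restrict (arc N j)

open Classical in
/-- The indices of the arcs of mass greater than `t`. -/
def heavyIndices (ρ : Measure Circle) (N : ℕ) (t : ℝ≥0∞) : Finset ℕ :=
  (Finset.range N).filter fun j => t < ρ (arc N j)

theorem sum_restrict_arc {N : ℕ} (hN : 0 < N) (ρ : Measure Circle) :
    ∑ j ∈ Finset.range N, ρ.restrict (arc N j) = ρ := by
  ext s hs
  rw [Measure.finsetSum_apply]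
  simp only [Measure.restrict_apply hs]
  rw [← measure_biUnion_finset]
  · congr 1
    refine Subset.antisymm (iUnion₂_subset fun j _ => inter_subset_left) fun x hx => ?_
    obtain ⟨j, hj, hxj⟩ := exists_mem_arc hN x
    exact mem_biUnion (Finset.mem_coe.2 (Finset.mem_range.2 hj)) ⟨hx, hxj⟩
  · intro i hi j hj hij
    exact (disjoint_arc (by simpa using hi) (by simpa using hj) hij).mono
      inter_subset_right inter_subset_right
  · exact fun j hj => hs.inter (measurableSet_arc (Finset.mem_range.1 hj))

theorem lightPart_add_heavyPart {N : ℕ} (hN : 0 < N) (ρ : Measure Circle) (t : ℝ≥0∞) :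
    lightPart ρ N t + heavyPart ρ N t = ρ := by
  rw [lightPart, heavyPart, ← Finset.sum_add_distrib]
  conv_rhs => rw [← sum_restrict_arc hN ρ]
  refine Finset.sum_congr rfl fun j _ => ?_
  rw [← add_smul, add_tsub_cancel_of_le (show keepRatio ρ N t j ≤ 1 from min_le_left _ _), one_smul]

theorem lightPart_arc {N j : ℕ} (hj : j < N) (ρ : Measure Circle) (t : ℝ≥0∞) :
    lightPart ρ N t (arc N j) = keepRatio ρ N t j * ρ (arc N j) := by
  rw [lightPart, Measure.finsetSum_apply, Finset.sum_eq_single j]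
  · rw [Measure.smul_apply, Measure.restrict_apply_self, smul_eq_mul]
  · intro i hi hij
    rw [Measure.smul_apply, Measure.restrict_apply (measurableSet_arc hj),
      (disjoint_arc hj (Finset.mem_range.1 hi) hij.symm).inter_eq, measure_empty, smul_zero]
  · simp [hj]

theorem lightPart_arc_le {N j : ℕ} (hj : j < N) (ρ : Measure Circle) (t : ℝ≥0∞) :
    lightPart ρ N t (arc N j) ≤ t := by
  rw [lightPart_arc hj, mul_comm]
  exact (mul_le_mul_right (min_le_right _ _) _).trans ENNReal.mul_div_le

/-- Truncation leaves each heavy arc with mass exactly t, and the arcs are disjoint. -/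
theorem card_heavyIndices_mul_le (N : ℕ) (ρ : Measure Circle) [IsFiniteMeasure ρ] (t : ℝ≥0∞) :
    (heavyIndices ρ N t).card * t ≤ lightPart ρ N t univ := by
  have h : ∀ j ∈ heavyIndices ρ N t, lightPart ρ N t (arc N j) = t := by
    intro j hj
    simp only [heavyIndices, Finset.mem_filter, Finset.mem_range] at hj
    have h0 : ρ (arc N j) ≠ 0 := (bot_le.trans_lt hj.2).ne'
    rw [lightPart_arc hj.1, keepRatio, min_eq_right, ENNReal.div_mul_cancel h0 (measure_ne_top _ _)]
    exact ENNReal.div_le_of_le_mul (by simpa using hj.2.le)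
  calc ((heavyIndices ρ N t).card : ℝ≥0∞) * t
      = ∑ j ∈ heavyIndices ρ N t, lightPart ρ N t (arc N j) := by
        rw [Finset.sum_congr rfl h, Finset.sum_const, nsmul_eq_mul]
    _ = lightPart ρ N t (⋃ j ∈ heavyIndices ρ N t, arc N j) := by
        rw [measure_biUnion_finset]
        · intro i hi j hj hij
          simp only [heavyIndices, Finset.coe_filter, Finset.mem_range, mem_ofPred_eq] at hi hj
          exact disjoint_arc hi.1 hj.1 hij
        · intro j hj
          simp only [heavyIndices, Finset.mem_filter, Finset.mem_range] at hj
          exact measurableSet_arc hj.1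
    _ ≤ lightPart ρ N t univ := measure_mono (subset_univ _)

/-- An arc of mass at most t is kept whole, so the excess lives on the heavy arcs. -/
theorem heavyPart_compl {N : ℕ} (ρ : Measure Circle) [IsFiniteMeasure ρ] (t : ℝ≥0∞) :
    heavyPart ρ N t (⋃ j ∈ heavyIndices ρ N t, arc N j)ᶜ = 0 := by
  rw [heavyPart, Measure.finsetSum_apply]
  refine Finset.sum_eq_zero fun j hj => ?_
  have hj' := Finset.mem_range.1 hj
  rw [Measure.smul_apply, smul_eq_mul]
  by_cases hjh : t < ρ (arc N j)
  · rw [Measure.restrict_apply' (measurableSet_arc hj')]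
    have hsub : arc N j ⊆ ⋃ j ∈ heavyIndices ρ N t, arc N j :=
      subset_biUnion_of_mem (u := arc N)
        (show j ∈ heavyIndices ρ N t by simp [heavyIndices, hj', hjh])
    rw [(disjoint_compl_left.mono_right hsub).inter_eq, measure_empty, mul_zero]
  -- Arcs without mass are separated because 0/0 = 0 in `ℝ≥0∞`, so their ratio need not be 1 when t
  -- = 0.
  · by_cases h0 : ρ (arc N j) = 0
    · rw [Measure.restrict_eq_zero.2 h0]; simp
    · have : keepRatio ρ N t j = 1 := by
        rw [keepRatio, min_eq_left]
        rw [ENNReal.le_div_iff_mul_le (Or.inl h0) (Or.inl (measure_ne_top _ _)), one_mul]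
        exact not_lt.1 hjh
      rw [this, tsub_self, zero_mul]

/-- The successive residuals of `μ` under truncation along the scales `N` at the levels `t`. -/
def residual (μ : Measure Circle) (N : ℕ → ℕ) (t : ℕ → ℝ≥0∞) : ℕ → Measure Circle
  | 0 => μ
  | k + 1 => heavyPart (residual μ N t k) (N k) (t k)

/-- The successive truncated pieces of `μ`. -/
def piece (μ : Measure Circle) (N : ℕ → ℕ) (t : ℕ → ℝ≥0∞) (k : ℕ) : Measure Circle :=
  lightPart (residual μ N t k) (N k) (t k)

/-- The heavy arcs of the `k`-th step. -/
def heavyAt (μ : Measure Circle) (N : ℕ → ℕ) (t : ℕ → ℝ≥0∞) (k : ℕ) : Finset ℕ :=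
  heavyIndices (residual μ N t k) (N k) (t k)

section

variable {μ : Measure Circle} {N : ℕ → ℕ} {t : ℕ → ℝ≥0∞}

theorem piece_add_residual (hN : ∀ k, 0 < N k) (k : ℕ) :
    piece μ N t k + residual μ N t (k + 1) = residual μ N t k :=
  lightPart_add_heavyPart (hN k) _ _

theorem sum_piece_add_residual (hN : ∀ k, 0 < N k) (m : ℕ) :
    ∑ k ∈ Finset.range m, piece μ N t k + residual μ N t m = μ := by
  induction m with
  | zero => simp [residual]
  | succ m ih => rw [Finset.sum_range_succ, add_assoc, piece_add_residual hN, ih]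

theorem residual_le (hN : ∀ k, 0 < N k) (k : ℕ) : residual μ N t k ≤ μ := by
  conv_rhs => rw [← sum_piece_add_residual (μ := μ) (t := t) hN k]
  exact Measure.le_add_left le_rfl

theorem heavyAt_subset (k : ℕ) {j : ℕ} (hj : j ∈ heavyAt μ N t k) : j < N k := by
  simp only [heavyAt, heavyIndices, Finset.mem_filter, Finset.mem_range] at hj
  exact hj.1

variable [IsFiniteMeasure μ]

theorem isFiniteMeasure_residual (hN : ∀ k, 0 < N k) (k : ℕ) :
    IsFiniteMeasure (residual μ N t k) := isFiniteMeasure_of_le μ (residual_le hN k)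

theorem isFiniteMeasure_piece (hN : ∀ k, 0 < N k) (k : ℕ) :
    IsFiniteMeasure (piece μ N t k) := by
  have := isFiniteMeasure_residual (μ := μ) (t := t) hN k
  refine isFiniteMeasure_of_le (residual μ N t k) ?_
  rw [← piece_add_residual hN k]
  exact Measure.le_add_right le_rfl

/-- The source of finite entropy: with t k proportional to log (1/W) at 1/N k, divided by N k, the
left side is a multiple of the entropy sum of the heavy arcs. -/
theorem tsum_card_heavyAt_le (hN : ∀ k, 0 < N k) :
    ∑' k, ((heavyAt μ N t k).card : ℝ≥0∞) * t k ≤ μ univ := by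
  refine ENNReal.tsum_le_of_sum_range_le fun m => ?_
  calc ∑ k ∈ Finset.range m, ((heavyAt μ N t k).card : ℝ≥0∞) * t k
      ≤ ∑ k ∈ Finset.range m, piece μ N t k univ := by
        refine Finset.sum_le_sum fun k _ => ?_
        have := isFiniteMeasure_residual (μ := μ) (t := t) hN k
        exact card_heavyIndices_mul_le _ _ _
    _ = (∑ k ∈ Finset.range m, piece μ N t k) univ := (Measure.finsetSum_apply _ _ _).symm
    _ ≤ μ univ := by
        conv_rhs => rw [← sum_piece_add_residual (μ := μ) (t := t) hN m]
        exact Measure.le_add_right le_rfl univ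

end

/-- The union of the arcs with indices in `H`. -/
def arcUnion (N : ℕ) (H : Finset ℕ) : Set Circle := ⋃ j ∈ H, arc N j

theorem measurableSet_arcUnion {N : ℕ} {H : Finset ℕ} (hH : ∀ j ∈ H, j < N) :
    MeasurableSet (arcUnion N H) :=
  Finset.measurableSet_biUnion _ fun j hj => measurableSet_arc (hH j hj)

theorem disjoint_arc_arcUnion {N : ℕ} {H : Finset ℕ} (hH : ∀ j ∈ H, j < N) {i : ℕ} (hi : i < N)
    (hiH : i ∉ H) : Disjoint (arc N i) (arcUnion N H) := by
  rw [arcUnion, disjoint_iUnion₂_right]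
  exact fun j hj => disjoint_arc hi (hH j hj) fun h => hiH (h ▸ hj)

theorem circleMeasure_arcUnion_le {N : ℕ} {H : Finset ℕ} (hH : ∀ j ∈ H, j < N) :
    circleMeasure (arcUnion N H) ≤ H.card * (N : ℝ≥0∞)⁻¹ := by
  refine (measure_biUnion_finset_le _ _).trans ?_
  rw [Finset.sum_congr rfl fun j hj => circleMeasure_arc (hH j hj), Finset.sum_const, nsmul_eq_mul]

theorem circleMeasure_closure_arcUnion_le {N : ℕ} {H : Finset ℕ} (hH : ∀ j ∈ H, j < N) :
    circleMeasure (closure (arcUnion N H)) ≤ 2 * (H.card * (N : ℝ≥0∞)⁻¹) := by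
  rw [arcUnion, H.closure_biUnion]
  refine (measure_biUnion_finset_le _ _).trans ?_
  have h : ∀ j ∈ H, circleMeasure (closure (arc N j)) ≤ 2 * (N : ℝ≥0∞)⁻¹ := by
    intro j hj
    obtain ⟨i, hi, hsub⟩ := exists_closure_arc_subset (hH j hj)
    refine (measure_mono hsub).trans ((measure_union_le _ _).trans_eq ?_)
    rw [circleMeasure_arc (hH j hj), circleMeasure_arc hi, two_mul]
  refine (Finset.sum_le_card_nsmul _ _ _ h).trans_eq ?_
  rw [nsmul_eq_mul]
  ring

/-- The next residual is carried by the current heavy arcs, so a finer arc outside them has mass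
zero and cannot exceed its threshold. -/
theorem arcUnion_heavyAt_succ_subset {μ : Measure Circle} [IsFiniteMeasure μ] {N : ℕ → ℕ}
    {t : ℕ → ℝ≥0∞} (hN : ∀ k, 0 < N k) (hdvd : ∀ k, N k ∣ N (k + 1)) (k : ℕ) :
    arcUnion (N (k + 1)) (heavyAt μ N t (k + 1)) ⊆ arcUnion (N k) (heavyAt μ N t k) := by
  have := isFiniteMeasure_residual (μ := μ) (t := t) hN k
  refine iUnion₂_subset fun j hj => ?_
  have hjN := heavyAt_subset (k + 1) hj
  obtain ⟨d, hd⟩ := hdvd k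
  have hd0 : 0 < d := by
    refine Nat.pos_of_ne_zero fun h => ?_
    have := hN (k + 1)
    rw [hd, h, mul_zero] at this
    exact lt_irrefl _ this
  have hsub : arc (N (k + 1)) j ⊆ arc (N k) (j / d) := by
    rw [hd]; exact arc_mul_subset _ _ _ hd0
  have hi : j / d < N k := by
    rw [Nat.div_lt_iff_lt_mul hd0, ← hd]; exact hjN
  by_cases hmem : j / d ∈ heavyAt μ N t k
  · exact hsub.trans (subset_biUnion_of_mem (u := arc (N k)) hmem)
  · exfalso
    have h0 : residual μ N t (k + 1) (arcUnion (N k) (heavyAt μ N t k))ᶜ = 0 :=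
      heavyPart_compl _ _
    have h1 : residual μ N t (k + 1) (arc (N (k + 1)) j) = 0 :=
      measure_mono_null (hsub.trans (disjoint_arc_arcUnion (fun j hj => heavyAt_subset k hj) hi
        hmem).subset_compl_right) h0
    simp only [heavyAt, heavyIndices, Finset.mem_filter] at hj
    rw [h1] at hj
    exact not_lt_bot hj.2

/-! ### Entropy of nested unions of arcs -/

theorem circleMeasure_image_Ioo {N j : ℕ} (hj : j < N) :
    circleMeasure (circleParam '' Ioo (j / N : ℝ) ((j + 1) / N)) = (N : ℝ≥0∞)⁻¹ := by
  have hN : (0 : ℝ) < N := by exact_mod_cast (by omega : 0 < N)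
  have hm : MeasurableSet (circleParam '' Ioo (j / N : ℝ) ((j + 1) / N)) :=
    (isOpenMap_circleParam _ isOpen_Ioo).measurableSet
  rw [circleMeasure_eq_map, Measure.map_apply measurable_circleParam hm,
    Measure.restrict_apply (measurable_circleParam hm),
    injOn_circleParam.preimage_image_inter (Ioo_subset_Ioc_self.trans (Ioc_div_subset hj)),
    Real.volume_Ioo, add_div, add_sub_cancel_left, one_div, ENNReal.ofReal_inv_of_pos hN,
    ENNReal.ofReal_natCast]

/-- If an arc of the subdivision avoids `E`, then any of its points outside a set `K ⊆ closure E`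
lies in a component of `Kᶜ` at least as long as the arc. -/
theorem inv_le_circleMeasure_component {N j : ℕ} (hj : j < N) {E K : Set Circle}
    (hd : Disjoint (arc N j) E) (hK : K ⊆ closure E) {y : Circle} (hy : y ∈ arc N j)
    (hyK : y ∉ K) : (N : ℝ≥0∞)⁻¹ ≤ circleMeasure (connectedComponentIn Kᶜ y) := by
  -- The open arc avoids the closure of E, whereas the half-open one may not. If y is the right
  -- endpoint, it is adjoined to the open arc without losing connectedness.
  set U := circleParam '' Ioo (j / N : ℝ) ((j + 1) / N) with hU
  have hlt : (j / N : ℝ) < (j + 1) / N := by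
    have hN : (0 : ℝ) < N := by exact_mod_cast (by omega : 0 < N)
    gcongr
    linarith
  have hUo : IsOpen U := isOpenMap_circleParam _ isOpen_Ioo
  have hUd : Disjoint U (closure E) :=
    (hd.mono_left (image_mono Ioo_subset_Ioc_self)).closure_right hUo
  have hycl : y ∈ closure U := by
    obtain ⟨s, hs, rfl⟩ := hy
    refine image_closure_subset_closure_image continuous_circleParam ⟨s, ?_, rfl⟩
    rw [closure_Ioo hlt.ne]
    exact ⟨hs.1.le, hs.2⟩
  have hUp : IsPreconnected U := isPreconnected_Ioo.image _ continuous_circleParam.continuousOn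
  have hSp : IsPreconnected (insert y U) :=
    hUp.subset_closure (subset_insert _ _) (insert_subset hycl subset_closure)
  have hSK : insert y U ⊆ Kᶜ :=
    insert_subset hyK fun x hx hxK => disjoint_left.1 hUd hx (hK hxK)
  have hsub : U ⊆ connectedComponentIn Kᶜ y :=
    (subset_insert _ _).trans (hSp.subset_connectedComponentIn (mem_insert _ _) hSK)
  rw [← circleMeasure_image_Ioo hj]
  exact measure_mono hsub

theorem isOpen_of_mem_complementaryArcs {K : Set Circle} (hK : IsClosed K) {I : Set Circle}
    (hI : I ∈ complementaryArcs K) : IsOpen I := by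
  obtain ⟨x, _, rfl⟩ := hI
  have : LocallyConnectedSpace Circle :=
    ChartedSpace.locallyConnectedSpace (EuclideanSpace ℝ (Fin 1)) Circle
  exact hK.isOpen_compl.connectedComponentIn

theorem eq_component_of_mem {K I : Set Circle} (hI : I ∈ complementaryArcs K) {y : Circle}
    (hy : y ∈ I) : y ∉ K ∧ I = connectedComponentIn Kᶜ y := by
  obtain ⟨x, _, rfl⟩ := hI
  exact ⟨connectedComponentIn_subset _ _ hy, connectedComponentIn_eq hy⟩

theorem pairwiseDisjoint_complementaryArcs (K : Set Circle) :
    (complementaryArcs K).PairwiseDisjoint id := by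
  intro I hI J hJ hIJ
  rw [Function.onFun, disjoint_left]
  intro y hyI hyJ
  exact hIJ ((eq_component_of_mem hI hyI).2.trans (eq_component_of_mem hJ hyJ).2.symm)

/-- A closed null set has finite entropy if some integrable function dominates `log (1 / W(|I|))`
on each complementary arc `I`. -/
theorem IsGoodWeight.hasFiniteEntropy_of_lintegral (hW : IsGoodWeight W) {K : Set Circle}
    (hK : IsClosed K) (hK0 : circleMeasure K = 0) (φ : Circle → ℝ≥0∞)
    (hφ : ∫⁻ x, φ x ∂circleMeasure ≠ ⊤)
    (hle : ∀ I ∈ complementaryArcs K, ∀ y ∈ I,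
      ENNReal.ofReal (logInv W (circleMeasure.real I)) ≤ φ y) :
    HasFiniteEntropy W K := by
  refine ⟨hK.isCompact, hK0, ?_⟩
  have hmeas : ∀ I ∈ complementaryArcs K, MeasurableSet I := fun I hI =>
    (isOpen_of_mem_complementaryArcs hK hI).measurableSet
  have hterm : ∀ I : complementaryArcs K,
      ENNReal.ofReal (gaugeFn W (circleMeasure.real (I : Set Circle)))
        ≤ ∫⁻ x in (I : Set Circle), φ x ∂circleMeasure := by
    rintro ⟨I, hI⟩
    have e : ENNReal.ofReal (gaugeFn W (circleMeasure.real I))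
        = ∫⁻ _ in I, ENNReal.ofReal (logInv W (circleMeasure.real I)) ∂circleMeasure := by
      rw [setLIntegral_const, gaugeFn, ENNReal.ofReal_mul measureReal_nonneg,
        ofReal_measureReal, mul_comm]
      rfl
    rw [e]
    exact setLIntegral_mono' (hmeas I hI) (hle I hI)
  have hsum : ∑' I : complementaryArcs K,
      ENNReal.ofReal (gaugeFn W (circleMeasure.real (I : Set Circle))) ≠ ⊤ := by
    refine ne_top_of_le_ne_top hφ ?_
    rw [ENNReal.tsum_eq_iSup_sum]
    refine iSup_le fun s => ?_
    calc ∑ I ∈ s, ENNReal.ofReal (gaugeFn W (circleMeasure.real (I : Set Circle)))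
        ≤ ∑ I ∈ s, ∫⁻ x in (I : Set Circle), φ x ∂circleMeasure :=
          Finset.sum_le_sum fun I _ => hterm I
      _ = ∫⁻ x in ⋃ I ∈ s, (I : Set Circle), φ x ∂circleMeasure := by
          rw [lintegral_biUnion_finset]
          · intro I _ J _ hIJ
            exact pairwiseDisjoint_complementaryArcs K I.2 J.2 fun h => hIJ (Subtype.ext h)
          · exact fun I _ => hmeas I I.2
      _ ≤ ∫⁻ x, φ x ∂circleMeasure := setLIntegral_le_lintegral _ _
  have hnn : ∀ I : complementaryArcs K, 0 ≤ gaugeFn W (circleMeasure.real (I : Set Circle)) := by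
    intro I
    rcases (measureReal_nonneg : 0 ≤ circleMeasure.real (I : Set Circle)).eq_or_lt with h | h
    · rw [← h, gaugeFn, zero_mul]
    · exact mul_nonneg h.le (hW.logInv_nonneg ⟨h, measureReal_le_one⟩)
  refine (ENNReal.summable_toReal hsum).congr fun I => ?_
  rw [ENNReal.toReal_ofReal (hnn I)]

/-- The limit set of a decreasing sequence of unions of arcs has finite entropy if the total
entropy of these unions is finite. -/
theorem IsGoodWeight.hasFiniteEntropy_iInter (hW : IsGoodWeight W) {N : ℕ → ℕ}
    (hN : ∀ k, 0 < N k) {H : ℕ → Finset ℕ} (hH : ∀ k, ∀ j ∈ H k, j < N k)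
    {D : ℝ} (hD : 0 ≤ D) (hL0 : 0 < logInv W (N 0 : ℝ)⁻¹)
    (hmono : ∀ k, logInv W (N 0 : ℝ)⁻¹ ≤ logInv W (N k : ℝ)⁻¹)
    (hDk : ∀ k, logInv W (N (k + 1) : ℝ)⁻¹ ≤ D * logInv W (N k : ℝ)⁻¹)
    (hsum : ∑' k, ((H k).card : ℝ≥0∞) * (N k : ℝ≥0∞)⁻¹ * ENNReal.ofReal (logInv W (N k : ℝ)⁻¹)
      ≠ ⊤) :
    HasFiniteEntropy W (⋂ k, closure (arcUnion (N k) (H k))) := by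
  classical
  set K := ⋂ k, closure (arcUnion (N k) (H k)) with hK
  set ℓ : ℕ → ℝ≥0∞ := fun k => ENNReal.ofReal (logInv W (N k : ℝ)⁻¹) with hℓ
  have hnull : circleMeasure K = 0 := by
    have h0 : Tendsto (fun k => 2 * (((H k).card : ℝ≥0∞) * (N k : ℝ≥0∞)⁻¹ * ℓ k)) atTop (𝓝 0) := by
      simpa using ENNReal.Tendsto.const_mul (ENNReal.tendsto_atTop_zero_of_tsum_ne_top hsum)
        (Or.inr (by simp : (2 : ℝ≥0∞) ≠ ⊤))
    -- The summands of the entropy series tend to 0 and control the measure of K times ℓ k, while ℓ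
    -- k ≥ ℓ 0 > 0.
    have h1 : circleMeasure K * ℓ 0 ≤ 0 := by
      refine ge_of_tendsto' h0 fun k => ?_
      calc circleMeasure K * ℓ 0 ≤ 2 * ((H k).card * (N k : ℝ≥0∞)⁻¹) * ℓ k := by
            gcongr
            · exact (measure_mono (iInter_subset _ k)).trans
                (circleMeasure_closure_arcUnion_le (hH k))
            · exact ENNReal.ofReal_le_ofReal (hmono k)
        _ = _ := by ring
    have h2 : ℓ 0 ≠ 0 := by simpa [hℓ] using hL0
    exact (mul_eq_zero.1 (le_bot_iff.1 h1)).resolve_right h2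
  -- A point of the k-th union is charged ℓ (k + 1), the price of leaving the unions at the next
  -- generation. Since ℓ (k + 1) ≤ D ℓ k, the integral is controlled by the entropy series.
  set φ : Circle → ℝ≥0∞ := fun x =>
    ℓ 0 + ∑' k, (arcUnion (N k) (H k)).indicator (fun _ => ℓ (k + 1)) x with hφ
  have hmE : ∀ k, MeasurableSet (arcUnion (N k) (H k)) := fun k => measurableSet_arcUnion (hH k)
  refine hW.hasFiniteEntropy_of_lintegral (isClosed_iInter fun k => isClosed_closure) hnull φ ?_ ?_
  · have hint : ∫⁻ x, φ x ∂circleMeasure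
        = ℓ 0 + ∑' k, ℓ (k + 1) * circleMeasure (arcUnion (N k) (H k)) := by
      rw [hφ, lintegral_add_left measurable_const, lintegral_const, measure_univ, mul_one,
        lintegral_tsum fun k => (measurable_const.indicator (hmE k)).aemeasurable]
      congr 2
      ext k
      rw [lintegral_indicator_const (hmE k)]
    rw [hint]
    refine ENNReal.add_ne_top.2 ⟨ENNReal.ofReal_ne_top, ?_⟩
    refine ne_top_of_le_ne_top (ENNReal.mul_ne_top (ENNReal.ofReal_ne_top (r := D)) hsum) ?_
    rw [← ENNReal.tsum_mul_left]
    refine ENNReal.tsum_le_tsum fun k => ?_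
    calc ℓ (k + 1) * circleMeasure (arcUnion (N k) (H k))
        ≤ (ENNReal.ofReal D * ℓ k) * ((H k).card * (N k : ℝ≥0∞)⁻¹) := by
          gcongr
          · rw [hℓ, ← ENNReal.ofReal_mul hD]
            exact ENNReal.ofReal_le_ofReal (hDk k)
          · exact circleMeasure_arcUnion_le (hH k)
      _ = _ := by ring
  · intro I hI y hy
    obtain ⟨hyK, rfl⟩ := eq_component_of_mem hI hy
    have hex : ∃ k, y ∉ arcUnion (N k) (H k) := by
      by_contra! h
      exact hyK (mem_iInter.2 fun k => subset_closure (h k))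
    -- k is the generation at which y first leaves the unions. Its arc there lies in no heavy arc,
    -- so its component has length at least 1/N k and costs at most ℓ k, which is charged at
    -- generation k - 1, or by the constant ℓ 0 if k = 0.
    set k := Nat.find hex with hk
    have hyk : y ∉ arcUnion (N k) (H k) := Nat.find_spec hex
    obtain ⟨j, hj, hyj⟩ := exists_mem_arc (hN k) y
    have hjH : j ∉ H k := fun h => hyk (mem_biUnion (Finset.mem_coe.2 h) hyj)
    have hlen := inv_le_circleMeasure_component hj (disjoint_arc_arcUnion (hH k) hj hjH)
      (iInter_subset _ k) hyj hyK
    have hlen' : (N k : ℝ)⁻¹ ≤ circleMeasure.real (connectedComponentIn Kᶜ y) := by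
      have := ENNReal.toReal_mono (measure_ne_top circleMeasure _) hlen
      simpa [Measure.real] using this
    have hNk : (0 : ℝ) < (N k : ℝ)⁻¹ := by have := hN k; positivity
    have h1 : ENNReal.ofReal (logInv W (circleMeasure.real (connectedComponentIn Kᶜ y))) ≤ ℓ k :=
      ENNReal.ofReal_le_ofReal (hW.logInv_antitone hNk hlen' measureReal_le_one)
    refine h1.trans ?_
    rcases Nat.eq_zero_or_pos k with h0 | hpos
    · rw [h0]; exact le_self_add
    · obtain ⟨q, hq⟩ := Nat.exists_eq_add_of_lt hpos
      rw [zero_add] at hq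
      have hyq : y ∈ arcUnion (N q) (H q) := not_not.1 (Nat.find_min hex (m := q) (by omega))
      rw [hq]
      calc ℓ (q + 1) = (arcUnion (N q) (H q)).indicator (fun _ => ℓ (q + 1)) y := by
            rw [indicator_of_mem hyq]
        _ ≤ ∑' k, (arcUnion (N k) (H k)).indicator (fun _ => ℓ (k + 1)) y :=
            ENNReal.le_tsum (f := fun k => (arcUnion (N k) (H k)).indicator (fun _ => ℓ (k + 1)) y) q
        _ ≤ φ y := le_add_self

/-! ### Cyclicity -/

/-- Inner functions of measures of small mass are close to `1` in the growth norm. -/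
theorem IsGoodWeight.exists_mass_singularInner_sub_one_le (hW : IsGoodWeight W) {ε : ℝ}
    (hε : 0 < ε) :
    ∃ η > 0, ∀ (ρ : Measure Circle) [IsFiniteMeasure ρ], ρ.real univ ≤ η →
      ∀ z ∈ ball (0 : ℂ) 1, W (1 - ‖z‖) * ‖singularInner ρ z - 1‖ ≤ ε := by
  have h := hW.tendsto_zero.eventually (gt_mem_nhds (half_pos hε))
  obtain ⟨a, ha, hsub⟩ := mem_nhdsGT_iff_exists_Ioo_subset.1 h
  have ha0 : 0 < a := ha
  -- Near the circle W < ε/2 beats the trivial bound 2; at distance at least a from it, a/2 keeps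
  -- the exponent within 1, where |exp w - 1| ≤ 2|w|, and εa/4 makes the result at most ε.
  refine ⟨min (a / 2) (ε * a / 4), by positivity, fun ρ _ hρ z hz => ?_⟩
  have hmem := one_sub_norm_mem hz
  have hw := hW.pos hz
  rcases lt_or_ge (1 - ‖z‖) a with hlt | hge
  · have h1 : W (1 - ‖z‖) < ε / 2 := hsub ⟨hmem.1, hlt⟩
    have h2 : ‖singularInner ρ z - 1‖ ≤ 2 := by
      refine (norm_sub_le _ _).trans ?_
      rw [norm_one]
      linarith [norm_singularInner_le_one ρ hz]
    calc W (1 - ‖z‖) * ‖singularInner ρ z - 1‖ ≤ ε / 2 * 2 := by gcongr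
      _ = ε := by ring
  · have h1 : 2 / (1 - ‖z‖) * ρ.real univ ≤ 2 / a * ρ.real univ := by gcongr
    have h2 : 2 / a * ρ.real univ ≤ 1 := by
      calc 2 / a * ρ.real univ ≤ 2 / a * (a / 2) := by
            gcongr; exact hρ.trans (min_le_left _ _)
        _ = 1 := by field_simp
    have h3 : 2 / a * ρ.real univ ≤ ε / 2 := by
      calc 2 / a * ρ.real univ ≤ 2 / a * (ε * a / 4) := by
            gcongr; exact hρ.trans (min_le_right _ _)
        _ = ε / 2 := by field_simp; norm_num
    have h4 := norm_singularInner_sub_one_le ρ hz (h1.trans h2)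
    calc W (1 - ‖z‖) * ‖singularInner ρ z - 1‖ ≤ 1 * ε := by
          gcongr
          · exact hW.le_one hz
          · linarith
      _ = ε := one_mul ε

theorem singularInner_eq_prod_mul_residual {μ : Measure Circle} [IsFiniteMeasure μ] {N : ℕ → ℕ}
    {t : ℕ → ℝ≥0∞} (hN : ∀ k, 0 < N k) {z : ℂ} (hz : z ∈ ball (0 : ℂ) 1) (m : ℕ) :
    singularInner μ z
      = (∏ k ∈ Finset.range m, singularInner (piece μ N t k) z)
        * singularInner (residual μ N t m) z := by
  induction m with
  | zero => simp [residual]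
  | succ m ih =>
    have := isFiniteMeasure_piece (μ := μ) (t := t) hN m
    have := isFiniteMeasure_residual (μ := μ) (t := t) hN (m + 1)
    rw [ih, ← piece_add_residual hN m, singularInner_add _ _ hz, Finset.prod_range_succ, mul_assoc]

/-- The telescoping estimate for products of approximate inverses along scales at which
`log (1 / W)` at least doubles. -/
theorem weight_mul_norm_prod_sub_one_le {w b A : ℝ} (hw : 0 ≤ w) (hb : 0 ≤ b) (hA : 1 ≤ A)
    {L : ℕ → ℝ} (hL0 : 0 ≤ L 0) (hL : ∀ k, 2 * L k ≤ L (k + 1))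
    (hq : A * Real.exp (-(b / 2 * L 0)) ≤ 1 / 2) {θ f : ℕ → ℂ} (hθ : ∀ k, ‖θ k‖ ≤ 1)
    (hf : ∀ k, ‖f k‖ ≤ A * Real.exp (b / 4 * L k))
    (hθf : ∀ k, w * ‖θ k * f k - 1‖ ≤ 2 * A * Real.exp (-(3 * b / 4 * L k))) (m : ℕ) :
    w * ‖∏ k ∈ Finset.range m, θ k * f k - 1‖ ≤ 4 * A * Real.exp (-(b / 2 * L 0)) := by
  have hA0 : 0 < A := one_pos.trans_le hA
  -- The exponents L 0 + ... + L (m - 1) sum to at most L m, since each L at least doubles the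
  -- previous one.
  have hprod : ∀ m, ‖∏ k ∈ Finset.range m, θ k * f k‖ ≤ A ^ m * Real.exp (b / 4 * L m) := by
    intro m
    induction m with
    | zero => simpa using Real.one_le_exp (by positivity : 0 ≤ b / 4 * L 0)
    | succ m ih =>
      rw [Finset.prod_range_succ, norm_mul, norm_mul]
      calc ‖∏ k ∈ Finset.range m, θ k * f k‖ * (‖θ m‖ * ‖f m‖)
          ≤ (A ^ m * Real.exp (b / 4 * L m)) * (1 * (A * Real.exp (b / 4 * L m))) := by
            gcongr
            · exact hθ m
            · exact hf m
        _ = A ^ (m + 1) * Real.exp (b / 4 * (2 * L m)) := by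
            rw [show b / 4 * (2 * L m) = b / 4 * L m + b / 4 * L m by ring, Real.exp_add]
            ring
        _ ≤ A ^ (m + 1) * Real.exp (b / 4 * L (m + 1)) := by
            gcongr
            exact hL m
  -- Linear growth suffices: it supplies one factor exp(-b L 0 / 2) for each factor A, and `hq`
  -- makes each such pair at most 1/2.
  have hLk : ∀ k : ℕ, (k + 1) * L 0 ≤ L k := by
    intro k
    induction k with
    | zero => simp
    | succ k ih =>
      have h1 := hL k
      push_cast
      have h2 : 0 ≤ (k : ℝ) * L 0 := by positivity
      linarith
  set e := Real.exp (-(b / 2 * L 0)) with he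
  have hterm : ∀ m, A ^ m * Real.exp (b / 4 * L m) * (2 * A * Real.exp (-(3 * b / 4 * L m)))
      ≤ 2 * A * e * (1 / 2) ^ m := by
    intro m
    calc A ^ m * Real.exp (b / 4 * L m) * (2 * A * Real.exp (-(3 * b / 4 * L m)))
        = 2 * A * A ^ m * Real.exp (-(b / 2 * L m)) := by
          rw [show -(b / 2 * L m) = b / 4 * L m + -(3 * b / 4 * L m) by ring, Real.exp_add]
          ring
      _ ≤ 2 * A * A ^ m * Real.exp (-(b / 2 * ((m + 1) * L 0))) := by
          gcongr
          exact hLk m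
      _ = 2 * A * e * (A * e) ^ m := by
          have h1 : Real.exp (-(b / 2 * ((m + 1) * L 0))) = e ^ (m + 1) := by
            rw [he, ← Real.exp_nat_mul]
            congr 1
            push_cast
            ring
          rw [h1]
          ring
      _ ≤ 2 * A * e * (1 / 2) ^ m := by gcongr
  have hmain : ∀ m, w * ‖∏ k ∈ Finset.range m, θ k * f k - 1‖
      ≤ 4 * A * e * (1 - (1 / 2) ^ m) := by
    intro m
    induction m with
    | zero => simp
    | succ m ih =>
      set G := ∏ k ∈ Finset.range m, θ k * f k with hG
      have h1 : ∏ k ∈ Finset.range (m + 1), θ k * f k - 1 = G * (θ m * f m - 1) + (G - 1) := by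
        rw [Finset.prod_range_succ]
        ring
      rw [h1]
      calc w * ‖G * (θ m * f m - 1) + (G - 1)‖
          ≤ w * (‖G‖ * ‖θ m * f m - 1‖ + ‖G - 1‖) := by
            gcongr
            exact (norm_add_le _ _).trans_eq (by rw [norm_mul])
        _ = ‖G‖ * (w * ‖θ m * f m - 1‖) + w * ‖G - 1‖ := by ring
        _ ≤ A ^ m * Real.exp (b / 4 * L m) * (2 * A * Real.exp (-(3 * b / 4 * L m)))
            + 4 * A * e * (1 - (1 / 2) ^ m) := by
            exact add_le_add (mul_le_mul (hprod m) (hθf m) (by positivity) (by positivity)) ih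
        _ ≤ 2 * A * e * (1 / 2) ^ m + 4 * A * e * (1 - (1 / 2) ^ m) := by
            gcongr ?_ + _
            exact hterm m
        _ = 4 * A * e * (1 - (1 / 2) ^ (m + 1)) := by ring
  refine (hmain m).trans (mul_le_of_le_one_right (by positivity) ?_)
  have : (0 : ℝ) ≤ (1 / 2) ^ m := by positivity
  linarith

/-- If `μ` does not charge sets of finite entropy, its residuals along suitable scales have masses
tending to zero. -/
theorem IsGoodWeight.tendsto_residual (hW : IsGoodWeight W) {μ : Measure Circle}
    [IsFiniteMeasure μ] (hμ : ∀ K : Set Circle, HasFiniteEntropy W K → μ K = 0) {N : ℕ → ℕ}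
    (hN : ∀ k, 0 < N k) (hdvd : ∀ k, N k ∣ N (k + 1)) {c D : ℝ} (hc : 0 < c) (hD : 0 ≤ D)
    (hL0 : 0 < logInv W (N 0 : ℝ)⁻¹)
    (hmono : ∀ k, logInv W (N 0 : ℝ)⁻¹ ≤ logInv W (N k : ℝ)⁻¹)
    (hDk : ∀ k, logInv W (N (k + 1) : ℝ)⁻¹ ≤ D * logInv W (N k : ℝ)⁻¹) :
    Tendsto (fun k => residual μ N
        (fun k => ENNReal.ofReal (c * logInv W (N k : ℝ)⁻¹ * (N k : ℝ)⁻¹)) (k + 1) univ)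
      atTop (𝓝 0) := by
  set t : ℕ → ℝ≥0∞ := fun k => ENNReal.ofReal (c * logInv W (N k : ℝ)⁻¹ * (N k : ℝ)⁻¹) with ht
  set E : ℕ → Set Circle := fun k => arcUnion (N k) (heavyAt μ N t k) with hE
  have hH : ∀ k, ∀ j ∈ heavyAt μ N t k, j < N k := fun k j hj => heavyAt_subset k hj
  have hLnn : ∀ k, 0 ≤ logInv W (N k : ℝ)⁻¹ := fun k => hL0.le.trans (hmono k)
  have hsum : ∑' k, ((heavyAt μ N t k).card : ℝ≥0∞) * (N k : ℝ≥0∞)⁻¹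
      * ENNReal.ofReal (logInv W (N k : ℝ)⁻¹) ≠ ⊤ := by
    intro htop
    have h1 := tsum_card_heavyAt_le (μ := μ) (t := t) hN
    have h2 : ∑' k, ((heavyAt μ N t k).card : ℝ≥0∞) * t k
        = ENNReal.ofReal c * ∑' k, ((heavyAt μ N t k).card : ℝ≥0∞) * (N k : ℝ≥0∞)⁻¹
          * ENNReal.ofReal (logInv W (N k : ℝ)⁻¹) := by
      rw [← ENNReal.tsum_mul_left]
      congr 1
      ext k
      have hNk : (0 : ℝ) < N k := by exact_mod_cast hN k
      have htk : t k = ENNReal.ofReal (c * logInv W (N k : ℝ)⁻¹ * (N k : ℝ)⁻¹) := rfl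
      rw [htk, ENNReal.ofReal_mul (mul_nonneg hc.le (hLnn k)), ENNReal.ofReal_mul hc.le,
        ENNReal.ofReal_inv_of_pos hNk, ENNReal.ofReal_natCast]
      ring
    rw [h2, htop, ENNReal.mul_top (by simpa using hc)] at h1
    exact measure_ne_top μ univ (top_le_iff.1 h1)
  have hent := hW.hasFiniteEntropy_iInter hN hH hD hL0 hmono hDk hsum
  have hinter : μ (⋂ k, E k) = 0 :=
    measure_mono_null (iInter_mono fun k => subset_closure) (hμ _ hent)
  have hanti : Antitone E := antitone_nat_of_succ_le fun k => arcUnion_heavyAt_succ_subset hN hdvd k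
  have hlim : Tendsto (fun k => μ (E k)) atTop (𝓝 0) := by
    rw [← hinter]
    exact tendsto_measure_iInter_atTop
      (fun k => (measurableSet_arcUnion (hH k)).nullMeasurableSet) hanti
      ⟨0, measure_ne_top _ _⟩
  refine tendsto_of_tendsto_of_tendsto_of_le_of_le tendsto_const_nhds hlim (fun _ => bot_le)
    fun k => ?_
  have := isFiniteMeasure_residual (μ := μ) (t := t) hN k
  have h0 : residual μ N t (k + 1) (E k)ᶜ = 0 := heavyPart_compl _ _
  calc residual μ N t (k + 1) univ
      ≤ residual μ N t (k + 1) (E k) + residual μ N t (k + 1) (E k)ᶜ := by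
        rw [← union_compl_self (E k)]
        exact measure_union_le _ _
    _ = residual μ N t (k + 1) (E k) := by rw [h0, add_zero]
    _ ≤ μ (E k) := residual_le hN (k + 1) _

/-- The constant `1` is approximated by bounded multiples of `Θ_μ`. Neither Dini-regularity of the
weight nor singularity of `μ` is needed for this direction. -/
theorem IsGoodWeight.exists_approx_one (hW : IsGoodWeight W) (μ : Measure Circle)
    [IsFiniteMeasure μ] (hμ : ∀ K : Set Circle, HasFiniteEntropy W K → μ K = 0) {ε : ℝ}
    (hε : 0 < ε) :
    ∃ (F : ℂ → ℂ) (B : ℝ), DifferentiableOn ℂ F (ball 0 1) ∧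
      (∀ z ∈ ball (0 : ℂ) 1, ‖F z‖ ≤ B) ∧
      ∀ z ∈ ball (0 : ℂ) 1, W (1 - ‖z‖) * ‖singularInner μ z * F z - 1‖ ≤ ε := by
  obtain ⟨C, τ, hC⟩ := hW.exists_isDoublingOn
  have hC0 : 0 < C := one_pos.trans hC.one_lt
  have hb : 0 < gain C := by unfold gain; positivity
  have hH := harnackConst_pos
  have hA := one_le_approxConst
  have hscale : Tendsto (fun m : ℕ => ((2 : ℝ) ^ m)⁻¹) atTop (𝓝[>] 0) :=
    tendsto_nhdsWithin_iff.2
      ⟨(tendsto_pow_atTop_atTop_of_one_lt one_lt_two).inv_tendsto_atTop,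
        Eventually.of_forall fun m => by simp⟩
  have hsmall : Tendsto (fun m : ℕ =>
      approxConst * Real.exp (-(gain C / 2 * logInv W ((2 : ℝ) ^ m)⁻¹))) atTop (𝓝 0) := by
    have h1 := (hW.tendsto_logInv.comp hscale).const_mul_atTop (half_pos hb)
    simpa using (Real.tendsto_exp_neg_atTop_nhds_zero.comp h1).const_mul approxConst
  -- The starting scale must satisfy 64δ ≤ τ for the doubling argument and L > 0. The bound 1/2
  -- makes the errors geometric, and ε/8 makes their total 4A exp(-bL/2) at most ε/2.
  obtain ⟨n₀, ⟨hn1, hn2⟩, hn3, hn4⟩ :=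
    (((hscale.eventually (Ioc_mem_nhdsGT (div_pos hC.pos (by norm_num : (0 : ℝ) < 64)))).and
      (((hW.tendsto_logInv.comp hscale).eventually_gt_atTop 0).and
        (hsmall.eventually (ge_mem_nhds
          (lt_min (by norm_num : (0 : ℝ) < 1 / 2) (by positivity : 0 < ε / 8))))))).exists
  have hn2' : ((2 : ℝ) ^ n₀)⁻¹ ≤ τ := hn2.trans (div_le_self hC.pos.le (by norm_num))
  obtain ⟨n, hn0, hnm, hnL⟩ := hW.exists_scales hC hn2' hn3
  set N : ℕ → ℕ := fun k => 2 ^ n k with hNdef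
  have hcast : ∀ k, (N k : ℝ) = 2 ^ n k := fun k => by simp [hNdef]
  simp only [← hcast] at hnL
  have hN : ∀ k, 0 < N k := fun k => by positivity
  have hdvd : ∀ k, N k ∣ N (k + 1) := fun k => pow_dvd_pow 2 (hnm k.le_succ)
  set L : ℕ → ℝ := fun k => logInv W (N k : ℝ)⁻¹ with hL
  have hN0 : (N 0 : ℝ) = 2 ^ n₀ := by rw [hcast, hn0]
  have hL0 : 0 < L 0 := by simpa only [hL, hN0, Function.comp_apply] using hn3
  have hmono : ∀ k, L 0 ≤ L k := by
    intro k
    induction k with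
    | zero => exact le_rfl
    | succ k ih => linarith [(hnL k).1]
  have hNk : ∀ k, (N k : ℝ)⁻¹ ≤ ((2 : ℝ) ^ n₀)⁻¹ := by
    intro k
    rw [hcast, ← hn0]
    gcongr
    · exact one_le_two
    · exact hnm (Nat.zero_le k)
  set c := gain C / (8 * harnackConst) with hc
  have hc0 : 0 < c := by positivity
  set t : ℕ → ℝ≥0∞ := fun k => ENNReal.ofReal (c * logInv W (N k : ℝ)⁻¹ * (N k : ℝ)⁻¹) with ht
  have hfin := isFiniteMeasure_piece (μ := μ) (t := t) hN
  have hfin' := isFiniteMeasure_residual (μ := μ) (t := t) hN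
  have happ := fun k => hW.exists_approx_inverse hC (hN k)
    (by have := hNk k; linarith) (hL0.trans_le (hmono k)) (piece μ N t k) (fun j hj => by
      have hnn : 0 ≤ c * logInv W (N k : ℝ)⁻¹ * (N k : ℝ)⁻¹ :=
        mul_nonneg (mul_nonneg hc0.le (hL0.le.trans (hmono k))) (by positivity)
      exact ENNReal.toReal_le_of_le_ofReal hnn (lightPart_arc_le hj _ _))
  choose f hfd hfB hfz using happ
  obtain ⟨η, hη, hclose⟩ := hW.exists_mass_singularInner_sub_one_le (half_pos hε)
  have hlim := hW.tendsto_residual hμ hN hdvd hc0 (D := 2 * C) (by positivity) hL0 hmono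
    fun k => (hnL k).2
  -- The product estimate is uniform in the number of factors, so m may be taken as large as the
  -- residual requires.
  obtain ⟨m, hm⟩ := (hlim.eventually (ge_mem_nhds (ENNReal.ofReal_pos.2 hη))).exists
  refine ⟨fun z => ∏ k ∈ Finset.range (m + 1), f k z,
    ∏ k ∈ Finset.range (m + 1), approxConst * Real.exp (gain C / 4 * logInv W (N k : ℝ)⁻¹),
    ?_, fun z hz => ?_, fun z hz => ?_⟩
  · exact (Differentiable.fun_finsetProd fun k _ => hfd k).differentiableOn
  · rw [norm_prod]
    exact Finset.prod_le_prod (fun _ _ => norm_nonneg _) fun k _ => hfB k z hz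
  · have hw := (hW.pos hz).le
    have hq : approxConst * Real.exp (-(gain C / 2 * L 0)) ≤ min (1 / 2) (ε / 8) := by
      simpa only [hL, hN0] using hn4
    have h1 := weight_mul_norm_prod_sub_one_le hw hb.le hA hL0.le (fun k => (hnL k).1)
      (hq.trans (min_le_left _ _)) (θ := fun k => singularInner (piece μ N t k) z)
      (f := fun k => f k z) (fun k => norm_singularInner_le_one _ hz) (fun k => hfB k z hz)
      (fun k => hfz k z hz) (m + 1)
    have h2 := hclose (residual μ N t (m + 1)) (ENNReal.toReal_le_of_le_ofReal hη.le hm) z hz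
    have hq' := hq.trans (min_le_right _ _)
    rw [Finset.prod_mul_distrib] at h1
    rw [singularInner_eq_prod_mul_residual (t := t) hN hz (m + 1)]
    set P := ∏ k ∈ Finset.range (m + 1), singularInner (piece μ N t k) z
    set F := ∏ k ∈ Finset.range (m + 1), f k z
    set R := singularInner (residual μ N t (m + 1)) z
    have hR : ‖R‖ ≤ 1 := norm_singularInner_le_one _ hz
    calc W (1 - ‖z‖) * ‖P * R * F - 1‖
        = W (1 - ‖z‖) * ‖R * (P * F - 1) + (R - 1)‖ := by ring_nf
      _ ≤ W (1 - ‖z‖) * (1 * ‖P * F - 1‖ + ‖R - 1‖) := by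
          gcongr
          refine (norm_add_le _ _).trans ?_
          rw [norm_mul]
          gcongr
      _ = W (1 - ‖z‖) * ‖P * F - 1‖ + W (1 - ‖z‖) * ‖R - 1‖ := by ring
      _ ≤ ε := by linarith

end GrowthSpace
end

theorem theorem3p1 (W : ℝ → ℝ) (hW : GrowthSpace.IsGoodWeight W)
    (hDini : GrowthSpace.IsDiniRegular W)
    (μ : MeasureTheory.Measure Circle) [MeasureTheory.IsFiniteMeasure μ]
    (hsing : μ.MutuallySingular GrowthSpace.circleMeasure)
    (hμ : ∀ K : Set Circle, GrowthSpace.HasFiniteEntropy W K → μ K = 0) :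
    GrowthSpace.IsCyclicVector W (GrowthSpace.singularInner μ) :=
  hW.isCyclicVector_of_approx_one (GrowthSpace.differentiableOn_singularInner μ)
    (fun _ hz => GrowthSpace.norm_singularInner_le_one μ hz)
    fun _ hε => hW.exists_approx_one μ hμ hε
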